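/- All graphs are finite, simple and undirected. A graph is uniquely hamiltonian if it has exactly one hamiltonian cycle (as a subgraph), and its degree set is the set of all its vertex degrees. For a finite set $M$ of natural numbers with $2\notin M$, a graph realizes $M$ if it is $3$-connected, uniquely hamiltonian, and has degree set exactly $M$; $M$ is uhc-realizable if some graph realizes it. A set $M=\{d_0<d_1<\dots<d_k\}$ with $k>0$ and $2\notin M$ is strongly uhc-realizable if for each partition of $\{d_1,\dots,d_k\}$ into two disjoint, possibly empty sets $D_1,D_2$ there are constants $c_1\in\mathbb{N}$ and $c_2\in\mathbb{R}$, $c_2>0$, and an infinite sequence of graphs $G_i=(V_i,E_i)$ realizing $M$, with $|V_1|<|V_2|<\cdots$, such that for every $i$, each $d\in D_1$ is the degree of at most $c_1$ vertices of $G_i$, and each $d'\in D_2$ is the degree of at least $c_2|V_i|$ vertices of $G_i$. Theorem. Let $M=\{3,d_1,\dots,d_k\}$ with $k\ge 0$ and $3<d_1<\dots<d_k$ be a finite set of natural numbers. Then $M$ is uhc-realizable if and only if $M$ contains an even number. If $M$ contains an even number, then $M$ is also strongly uhc-realizable. -/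

import Mathlib

namespace UHC

/-- A finite graph is `k`-connected if it has more than `k` vertices and deleting any set of fewer
than `k` vertices leaves a connected graph. -/
def IsKConnected {V : Type} [Fintype V] (G : SimpleGraph V) (k : ℕ) : Prop :=
  k < Fintype.card V ∧
    ∀ S : Finset V, S.card < k → (G.induce {v : V | v ∉ S}).Connected

open Classical in
/-- `C` is the edge set of a hamiltonian cycle of `G`. Closed walks that differ only in the starting
vertex or in the orientation have the same edge set, so a hamiltonian cycle, regarded as a subgraph,
is the same thing as such a set `C`. -/
def IsHamiltonianCycleEdgeSet {V : Type} (G : SimpleGraph V) (C : Set (Sym2 V)) : Prop :=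
  ∃ (a : V) (p : G.Walk a a), p.IsHamiltonianCycle ∧ {e | e ∈ p.edges} = C

/-- A graph is uniquely hamiltonian if it has exactly one hamiltonian cycle. -/
def IsUniquelyHamiltonian {V : Type} (G : SimpleGraph V) : Prop :=
  ∃! C : Set (Sym2 V), IsHamiltonianCycleEdgeSet G C

open Classical in
/-- The degree set of a finite graph. -/
noncomputable def degreeSet {V : Type} [Fintype V] (G : SimpleGraph V) : Set ℕ :=
  Set.range fun v : V => G.degree v

open Classical in
/-- The number of vertices of degree `d`. -/
noncomputable def numDegree {V : Type} [Fintype V] (G : SimpleGraph V) (d : ℕ) : ℕ :=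
  (Finset.univ.filter fun v : V => G.degree v = d).card

/-- `G` realizes `M`: it is uniquely hamiltonian, its degree set is `M`, and it is `2`-connected if
`2 ∈ M` and `3`-connected otherwise. -/
def Realizes {V : Type} [Fintype V] (G : SimpleGraph V) (M : Finset ℕ) : Prop :=
  IsKConnected G (if 2 ∈ M then 2 else 3) ∧ IsUniquelyHamiltonian G ∧ degreeSet G = (M : Set ℕ)

/-- Some finite graph realizes `M`. (Every finite graph is isomorphic to one whose vertex type lives
in `Type`.) -/
def UhcRealizable (M : Finset ℕ) : Prop :=
  ∃ (V : Type) (_ : Fintype V) (G : SimpleGraph V), Realizes G M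

/-- `M` has at least two elements and, for each partition of the non-minimal elements of `M` into two
(possibly empty) parts `D₁`, `D₂`, there are constants `c₁`, `c₂ > 0` and an infinite sequence of
finite graphs of strictly increasing order realizing `M`, each with at most `c₁` vertices of every
degree in `D₁` and at least a fraction `c₂` of its vertices of every degree in `D₂`. -/
def StronglyUhcRealizable (M : Finset ℕ) : Prop :=
  ∃ hM : M.Nonempty, 1 < M.card ∧
    ∀ D₁ D₂ : Finset ℕ, Disjoint D₁ D₂ → D₁ ∪ D₂ = M.erase (M.min' hM) →
      ∃ (c₁ : ℕ) (c₂ : ℝ), 0 < c₂ ∧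
        ∃ (V : ℕ → Type) (_ : ∀ i, Fintype (V i)) (G : ∀ i, SimpleGraph (V i)),
          StrictMono (fun i => Fintype.card (V i)) ∧
          ∀ i, Realizes (G i) M ∧
            (∀ d ∈ D₁, numDegree (G i) d ≤ c₁) ∧
            (∀ d ∈ D₂, c₂ * (Fintype.card (V i) : ℝ) ≤ (numDegree (G i) d : ℝ))

end UHC

/-! Necessity is Thomason's parity theorem. Fix an edge `x y` and consider the hamiltonian paths
that begin with `x`, `y`. Whenever the last vertex has a neighbour in an admissible position on the
path, reversing the part behind that neighbour gives another such path, and the same operation leads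
back. Hence the pairs of a path and an admissible rotation are even in number. If all degrees are
odd, a path has an odd number of rotations exactly when its last vertex is adjacent to `x`, so an
even number of these paths close up to a hamiltonian cycle. A hamiltonian cycle is therefore never
alone (`even_card_closed_paths`, `not_uniqueHC_of_odd`).

Sufficiency is a construction by gluing. A cubic vertex of `G` with neighbours `a₀`, `a₁`, `w` is
replaced by the rest of a graph `H` with one vertex deleted: `a₀` is joined to `b₀`, `a₁` to `b₁`,
and `w` to all vertices of a set `W`. A hamiltonian cycle of the result that has at most one edge
between `w` and `W` contracts to hamiltonian cycles of `G` and `H`. One with two such edges would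
give a hamiltonian cycle of `H` with its deleted vertex split in two, which the choice of `H`
excludes. So if `G` is uniquely hamiltonian with a cycle missing the edge to `w`, and `H` has only
one hamiltonian cycle missing the edges to `W`, then the gluing is uniquely hamiltonian
(`Socket.uniqueHC`). Connectivity after deletion of two vertices is inherited (`Socket.conn`).

Four small graphs, verified by exhaustive search, suffice. Two copies of a graph on 13 vertices give
a uniquely hamiltonian start with two vertices of degree 4 and otherwise cubic ones (`good_base`). A
piece of the Petersen graph raises the degree of one vertex by 2 and adds only cubic vertices
(`Good.grow`). A triangle or a wheel inserted at a cubic vertex yields a new special vertex of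
degree 3 or 4, which can then be grown to any odd or even degree (`Good.fan`, `exists_enlarge`). An
even element of `M` is needed only for the start, whose two vertices of degree 4 must grow to a
degree in `M`. Every further degree can be added arbitrarily often without affecting the others,
which gives strong realizability. -/

namespace UHC

/-- The degree of a vertex, as the cardinality of its neighbourhood. -/
noncomputable abbrev dg {V : Type} (G : SimpleGraph V) (v : V) : ℕ := (G.neighborSet v).ncard

/-- A connected graph in which all vertices have degree two, that is, a hamiltonian cycle on its
vertex set. -/
structure IsHC {V : Type} (C : SimpleGraph V) : Prop where
  conn : C.Connected
  deg : ∀ v, dg C v = 2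

/-! ### Hamiltonian cycles as connected 2-regular spanning subgraphs -/

section Walks

variable {V : Type} [Finite V] {C : SimpleGraph V}

open Classical in
lemma IsHC.exists_walk (h : IsHC C) {s t : V} (hst : C.Adj s t) :
    ∃ p : C.Walk s s, p.IsHamiltonianCycle ∧ p.snd = t ∧ ∀ u v, p.toSubgraph.Adj u v ↔ C.Adj u v := by
  have := Fintype.ofFinite V
  have hc : C.IsCycles := fun v _ => h.deg v
  obtain ⟨p, hp, hv⟩ := hc.exists_cycle_toSubgraph_verts_eq_connectedComponentSupp
    (c := C.connectedComponentMk s) (v := s) rfl ⟨t, hst⟩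
  have hall : ∀ v, v ∈ p.toSubgraph.verts := by
    intro v
    rw [hv, SimpleGraph.ConnectedComponent.mem_supp_iff, SimpleGraph.ConnectedComponent.eq]
    exact h.conn.preconnected _ _
  have hadj : ∀ u v, p.toSubgraph.Adj u v ↔ C.Adj u v := fun u v =>
    hp.adj_toSubgraph_iff_of_isCycles hc (hall u) v
  obtain ⟨q, hq, hqs, hqv⟩ := hp.exists_isCycle_snd_verts_eq ((hadj s t).2 hst)
  refine ⟨q, ?_, hqs, fun u v => hq.adj_toSubgraph_iff_of_isCycles hc (hqv ▸ hall u) v⟩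
  rw [SimpleGraph.Walk.isHamiltonianCycle_iff_isCycle_and_support_count_tail_eq_one]
  refine ⟨hq, fun a => ?_⟩
  have ha : a ∈ q.support := q.mem_verts_toSubgraph.1 (hqv ▸ hall a)
  apply List.count_eq_one_of_mem hq.support_nodup
  rcases List.mem_cons.1 (q.cons_tail_support ▸ ha) with h1 | h1
  · rw [h1]; exact SimpleGraph.Walk.end_mem_tail_support hq.not_nil
  · exact h1

/-- Replaces closed walks by spanning subgraphs, to which contraction and degree arguments apply. A
connected 2-regular graph is traversed by one cycle, since the cycle through an edge fills its
component. -/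
theorem isHamiltonianCycleEdgeSet_iff (G : SimpleGraph V) (S : Set (Sym2 V)) :
    IsHamiltonianCycleEdgeSet G S ↔ ∃ C : SimpleGraph V, C ≤ G ∧ IsHC C ∧ C.edgeSet = S := by
  classical
  have := Fintype.ofFinite V
  constructor
  · rintro ⟨a, p, hp, rfl⟩
    refine ⟨p.toSubgraph.spanningCoe, p.toSubgraph.spanningCoe_le, ⟨?_, fun v => ?_⟩, ?_⟩
    · have hsp : p.toSubgraph.IsSpanning := fun v => p.mem_verts_toSubgraph.2 (by
        have := hp.mem_support v
        convert this)
      exact (p.toSubgraph.spanningCoeEquivCoeOfSpanning hsp).connected_iff.2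
        p.toSubgraph_connected.coe
    · exact hp.isCycle.ncard_neighborSet_toSubgraph_eq_two (hp.mem_support v)
    · ext e
      rw [SimpleGraph.Subgraph.edgeSet_spanningCoe, SimpleGraph.Walk.mem_edges_toSubgraph]
      rfl
  · rintro ⟨C, hCG, hC, rfl⟩
    obtain ⟨s⟩ := hC.conn.nonempty
    obtain ⟨t, ht⟩ := Set.nonempty_of_ncard_ne_zero (s := C.neighborSet s) (by
      have := hC.deg s; simp only [dg] at this; omega)
    obtain ⟨p, hp, -, hadj⟩ := hC.exists_walk ht
    refine ⟨s, p.mapLe hCG, ?_, ?_⟩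
    · have := hp.map (f := SimpleGraph.Hom.ofLE hCG) Function.bijective_id
      convert this
    · ext e
      simp only [SimpleGraph.Walk.edges_mapLe_eq_edges, Set.mem_ofPred_eq]
      rw [← SimpleGraph.Walk.mem_edges_toSubgraph]
      induction e with
      | _ u v => exact hadj u v

/-- `C` is the only hamiltonian cycle of `G`. -/
def UniqueHC (G C : SimpleGraph V) : Prop :=
  (C ≤ G ∧ IsHC C) ∧ ∀ C', C' ≤ G → IsHC C' → C' = C

theorem isUniquelyHamiltonian_iff (G : SimpleGraph V) :
    IsUniquelyHamiltonian G ↔ ∃ C, UniqueHC G C := by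
  constructor
  · rintro ⟨S, hS, hu⟩
    obtain ⟨C, hle, hC, rfl⟩ := (isHamiltonianCycleEdgeSet_iff G S).1 hS
    exact ⟨C, ⟨hle, hC⟩, fun C' h1 h2 => SimpleGraph.edgeSet_inj.1
      (hu _ ((isHamiltonianCycleEdgeSet_iff G _).2 ⟨C', h1, h2, rfl⟩))⟩
  · rintro ⟨C, ⟨hle, hC⟩, hu⟩
    refine ⟨C.edgeSet, (isHamiltonianCycleEdgeSet_iff G _).2 ⟨C, hle, hC, rfl⟩, fun S hS => ?_⟩
    obtain ⟨C', h1, h2, rfl⟩ := (isHamiltonianCycleEdgeSet_iff G S).1 hS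
    rw [hu C' h1 h2]

end Walks

lemma degree_eq_dg {V : Type} (G : SimpleGraph V) (v : V) [Fintype (G.neighborSet v)] :
    G.degree v = dg G v := by
  rw [dg, ← SimpleGraph.card_neighborSet_eq_degree, Set.ncard_eq_toFinset_card', Set.toFinset_card]

/-! ### Handshaking -/

section Parity

variable {V : Type} [Finite V]

/-- The handshaking lemma. -/
lemma even_ncard_odd_dg (G : SimpleGraph V) : Even {v | Odd (dg G v)}.ncard := by
  classical
  have := Fintype.ofFinite V
  have := G.even_card_odd_degree_vertices
  rw [← Set.ncard_coe_finset] at this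
  convert this using 2
  ext v
  simp [degree_eq_dg]

lemma even_dg_of_forall_ne (G : SimpleGraph V) (x : V) (h : ∀ v, v ≠ x → Even (dg G v)) :
    Even (dg G x) := by
  by_contra hx
  have : {v | Odd (dg G v)} = {x} := by
    ext v
    simp only [Set.mem_ofPred_eq, Set.mem_singleton_iff]
    constructor
    · intro hv; by_contra hne; exact (Nat.not_odd_iff_even.2 (h v hne)) hv
    · rintro rfl; exact Nat.not_even_iff_odd.1 hx
  have h2 := even_ncard_odd_dg G
  rw [this, Set.ncard_singleton] at h2
  exact absurd h2 (by decide)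

/-- Meant for a cycle in which one side of a small cut has been contracted to `x`. The degree of `x`
is even by handshaking and positive by connectivity, so the bound 3 leaves only 2. -/
lemma dg_eq_two_of_conn {G : SimpleGraph V} (hG : G.Connected) [Nontrivial V] (x : V)
    (h : ∀ v, v ≠ x → dg G v = 2) (hx : dg G x ≤ 3) : IsHC G := by
  refine ⟨hG, fun v => ?_⟩
  by_cases hv : v = x
  · subst hv
    have h1 : Even (dg G v) := even_dg_of_forall_ne G v fun u hu => by rw [h u hu]; decide
    obtain ⟨u, hu⟩ := hG.preconnected.exists_adj_of_nontrivial v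
    have h2 : 0 < dg G v := (Set.ncard_pos (Set.toFinite _)).2 ⟨u, hu⟩
    obtain ⟨k, hk⟩ := h1
    omega
  · exact h v hv

end Parity

/-! ### Deleting vertices, and 3-connectivity -/

section Deletion

variable {V : Type}

/-- The graph `G` with all edges at vertices of `S` removed. -/
def del (G : SimpleGraph V) (S : Set V) : SimpleGraph V where
  Adj u v := G.Adj u v ∧ u ∉ S ∧ v ∉ S
  symm.symm _ _ h := ⟨h.1.symm, h.2.2, h.2.1⟩
  loopless.irrefl _ h := G.irrefl h.1

/-- Any two vertices outside `S` are joined by a path avoiding `S`. -/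
def ConnOff (G : SimpleGraph V) (S : Set V) : Prop :=
  ∀ u v, u ∉ S → v ∉ S → (del G S).Reachable u v

lemma connOff_iff (G : SimpleGraph V) (S : Set V) :
    (G.induce {v | v ∉ S}).Preconnected ↔ ConnOff G S := by
  constructor
  · intro h u v hu hv
    exact (h ⟨u, hu⟩ ⟨v, hv⟩).map (⟨fun x => x.1, fun {a b} hab => ⟨hab, a.2, b.2⟩⟩ :
      G.induce {v | v ∉ S} →g del G S)
  · rintro h ⟨u, hu⟩ ⟨v, hv⟩
    have key : ∀ {a b : V} (p : (del G S).Walk a b) (ha : a ∉ S) (hb : b ∉ S),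
        (G.induce {v | v ∉ S}).Reachable ⟨a, ha⟩ ⟨b, hb⟩ := by
      intro a b p
      induction p with
      | nil => intro _ _; exact .rfl
      | cons hab p ih =>
        intro ha hb
        exact SimpleGraph.Reachable.trans
          (SimpleGraph.Adj.reachable (show (G.induce {v | v ∉ S}).Adj ⟨_, ha⟩ ⟨_, hab.2.2⟩ from hab.1))
          (ih hab.2.2 hb)
    obtain ⟨p⟩ := h u v hu hv
    exact key p hu hv

theorem isKConnected_three_iff [Fintype V] (G : SimpleGraph V) :
    IsKConnected G 3 ↔ 3 < Fintype.card V ∧ ∀ x y : V, ConnOff G {x, y} := by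
  classical
  refine and_congr_right fun hV => ⟨fun h x y => ?_, fun h S hS => ?_⟩
  · have := (h {x, y} (lt_of_le_of_lt (Finset.card_le_two) (by norm_num))).preconnected
    have e : {v | v ∉ ({x, y} : Finset V)} = {v | v ∉ ({x, y} : Set V)} := by ext; simp
    rw [← connOff_iff, ← e]
    exact this
  · have hne : Nonempty {v : V | v ∉ S} := by
      by_contra hc
      have : S = Finset.univ := by
        ext v
        simp only [Finset.mem_univ, iff_true]
        by_contra hv
        exact hc ⟨⟨v, hv⟩⟩
      rw [this, Finset.card_univ] at hS
      omega
    refine ⟨?_⟩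
    have hle : S.card ≤ 2 := by omega
    obtain ⟨x, hx⟩ : ∃ x, x ∉ S := ⟨hne.some.1, hne.some.2⟩
    have hpre : ∀ T : Set V, ((S : Set V) = T) → ConnOff G T →
        (G.induce {v | v ∉ S}).Preconnected := by
      rintro T rfl hT
      exact (connOff_iff G (S : Set V)).2 hT
    interval_cases hc : S.card
    · -- an empty set is handled through a set with one vertex
      have hS0 := Finset.card_eq_zero.1 hc
      refine hpre ∅ (by simp [hS0]) fun u v _ _ => ?_
      obtain ⟨z, hz⟩ : ∃ z, z ∉ ({u, v} : Finset V) := by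
        by_contra hcon
        push Not at hcon
        have := Finset.card_le_card (fun z (_ : z ∈ Finset.univ) => hcon z)
        have h2 := Finset.card_le_two (a := u) (b := v)
        rw [Finset.card_univ] at this
        omega
      simp only [Finset.mem_insert, Finset.mem_singleton, not_or] at hz
      refine (h z z u v (by simp [Ne.symm hz.1]) (by simp [Ne.symm hz.2])).mono ?_
      exact fun a b hab => ⟨hab.1, id, id⟩
    · obtain ⟨a, ha⟩ := Finset.card_eq_one.1 hc
      exact hpre {a, a} (by simp [ha]) (h a a)
    · obtain ⟨a, b, -, ha⟩ := Finset.card_eq_two.1 hc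
      exact hpre {a, b} (by simp [ha]) (h a b)

end Deletion

/-! ### Gluing two graphs at a vertex: degrees and connectivity -/

section Glue

variable {A B : Type}

/-- The graph obtained from `G` and `H` by deleting the vertices `none` and adding the edges
described by `X` between the remaining parts. -/
def glue (G : SimpleGraph (Option A)) (H : SimpleGraph (Option B)) (X : A → B → Prop) :
    SimpleGraph (A ⊕ B) where
  Adj
    | .inl a, .inl a' => G.Adj (some a) (some a')
    | .inr b, .inr b' => H.Adj (some b) (some b')
    | .inl a, .inr b => X a b
    | .inr b, .inl a => X a b
  symm.symm x y h := by
    rcases x with a | a <;> rcases y with b | b <;> first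
      | exact h
      | exact SimpleGraph.Adj.symm (G := G) h
      | exact SimpleGraph.Adj.symm (G := H) h
  loopless.irrefl x h := by
    rcases x with a | a
    · exact G.irrefl h
    · exact H.irrefl h

variable {G : SimpleGraph (Option A)} {H : SimpleGraph (Option B)} {X : A → B → Prop}

@[simp] lemma glue_inl_inl (a a' : A) :
    (glue G H X).Adj (.inl a) (.inl a') ↔ G.Adj (some a) (some a') := Iff.rfl
@[simp] lemma glue_inr_inr (b b' : B) :
    (glue G H X).Adj (.inr b) (.inr b') ↔ H.Adj (some b) (some b') := Iff.rfl
@[simp] lemma glue_inl_inr (a : A) (b : B) : (glue G H X).Adj (.inl a) (.inr b) ↔ X a b := Iff.rfl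
@[simp] lemma glue_inr_inl (a : A) (b : B) : (glue G H X).Adj (.inr b) (.inl a) ↔ X a b := Iff.rfl

/-- Gluing is symmetric in the two sides. -/
lemma glue_comap_swap :
    (glue G H X).comap (Equiv.sumComm B A) = glue H G (fun b a => X a b) := by
  ext x y
  rcases x with a | a <;> rcases y with b | b <;> rfl

lemma dg_glue_inl [Finite A] [Finite B] {a : A} {b : B}
    (h : ∀ b', X a b' ↔ b' = b ∧ G.Adj (some a) none) :
    dg (glue G H X) (.inl a) = dg G (some a) := by
  classical
  let φ : Option A → A ⊕ B := fun o => o.elim (.inr b) .inl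
  have hφ : Function.Injective φ := by
    rintro (_ | x) (_ | y) hxy <;> simp_all [φ]
  rw [dg, dg, ← Set.ncard_image_of_injective _ hφ]
  congr 1
  ext (x | x)
  · simp only [SimpleGraph.mem_neighborSet, glue_inl_inl, Set.mem_image]
    constructor
    · intro hx; exact ⟨some x, hx, rfl⟩
    · rintro ⟨(_ | y), hy, hxy⟩
      · simp [φ] at hxy
      · simp only [φ, Option.elim, Sum.inl.injEq] at hxy; exact hxy ▸ hy
  · simp only [SimpleGraph.mem_neighborSet, glue_inl_inr, Set.mem_image, h]
    constructor
    · rintro ⟨rfl, hx⟩; exact ⟨none, hx, rfl⟩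
    · rintro ⟨(_ | y), hy, hxy⟩
      · simp only [φ, Option.elim, Sum.inr.injEq] at hxy; exact ⟨hxy.symm, hy⟩
      · simp [φ] at hxy

lemma dg_comap_equiv {V V' : Type} (e : V ≃ V') (G : SimpleGraph V') (v : V) :
    dg (G.comap e) v = dg G (e v) := by
  rw [dg, dg, ← Set.ncard_image_of_injective _ e.injective]
  congr 1
  ext x
  simp only [Set.mem_image, SimpleGraph.mem_neighborSet, SimpleGraph.comap_adj]
  constructor
  · rintro ⟨y, hy, rfl⟩; exact hy
  · intro hx; exact ⟨e.symm x, by simpa using hx, by simp⟩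

lemma dg_glue_inr [Finite A] [Finite B] {a : A} {b : B}
    (h : ∀ a', X a' b ↔ a' = a ∧ H.Adj (some b) none) :
    dg (glue G H X) (.inr b) = dg H (some b) := by
  rw [← dg_glue_inl (G := H) (H := G) (X := fun b a => X a b) (a := b) (b := a) h,
    ← glue_comap_swap, dg_comap_equiv]
  rfl

/-- A walk to `none` can be cut off at its first arrival. -/
lemma exists_adj_none_of_reachable {S : Set (Option A)} {a : A}
    (h : (del G S).Reachable (some a) none) :
    ∃ a', some a' ∉ S ∧ G.Adj none (some a') ∧
      (del (G.comap some) {x | some x ∈ S}).Reachable a a' := by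
  obtain ⟨p⟩ := h
  have key : ∀ {u v : Option A} (p : (del G S).Walk u v) (a : A), u = some a → v = none →
      ∃ a', some a' ∉ S ∧ G.Adj none (some a') ∧
        (del (G.comap some) {x | some x ∈ S}).Reachable a a' := by
    intro u v p
    induction p with
    | nil => intro a h1 h2; simp [h1] at h2
    | @cons u w v huw p ih =>
      rintro a rfl rfl
      rcases w with _ | w
      · exact ⟨a, huw.2.1, huw.1.symm, .rfl⟩
      · obtain ⟨a', h1, h2, h3⟩ := ih w rfl rfl
        exact ⟨a', h1, h2, SimpleGraph.Reachable.trans (SimpleGraph.Adj.reachable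
          (show (del (G.comap some) _).Adj a w from ⟨huw.1, huw.2.1, huw.2.2⟩)) h3⟩
  exact key p a rfl rfl

lemma reachable_of_none_mem {S : Set (Option A)} {a a' : A} (hS : none ∈ S)
    (h : (del G S).Reachable (some a) (some a')) :
    (del (G.comap some) {x | some x ∈ S}).Reachable a a' := by
  obtain ⟨p⟩ := h
  have key : ∀ {u v : Option A} (p : (del G S).Walk u v) (a a' : A), u = some a → v = some a' →
        (del (G.comap some) {x | some x ∈ S}).Reachable a a' := by
    intro u v p
    induction p with
    | nil => intro a a' h1 h2; rw [h1] at h2; rw [Option.some.inj h2]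
    | @cons u w v huw p ih =>
      rintro a a' rfl rfl
      rcases w with _ | w
      · exact absurd hS huw.2.2
      · exact SimpleGraph.Reachable.trans (SimpleGraph.Adj.reachable
          (show (del (G.comap some) _).Adj a w from ⟨huw.1, huw.2.1, huw.2.2⟩)) (ih w a' rfl rfl)
  exact key p a a' rfl rfl

lemma reachable_glue_inl {S : Set (A ⊕ B)} {T : Set A} (hT : ∀ x, .inl x ∈ S → x ∈ T) {a a' : A}
    (h : (del (G.comap some) T).Reachable a a') :
    (del (glue G H X) S).Reachable (.inl a) (.inl a') :=
  h.map (⟨Sum.inl, fun {_ _} hab => ⟨hab.1, fun h => hab.2.1 (hT _ h), fun h => hab.2.2 (hT _ h)⟩⟩ :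
    del (G.comap some) T →g del (glue G H X) S)

lemma reachable_glue_inr {S : Set (A ⊕ B)} {T : Set B} (hT : ∀ x, .inr x ∈ S → x ∈ T) {b b' : B}
    (h : (del (H.comap some) T).Reachable b b') :
    (del (glue G H X) S).Reachable (.inr b) (.inr b') :=
  h.map (⟨Sum.inr, fun {_ _} hab => ⟨hab.1, fun h => hab.2.1 (hT _ h), fun h => hab.2.2 (hT _ h)⟩⟩ :
    del (H.comap some) T →g del (glue G H X) S)

lemma connOff_comap_some (hG : ∀ x y, ConnOff G {x, y}) (x : Option A) :
    ConnOff (G.comap some) {a | some a = x} := by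
  intro u v hu hv
  refine (reachable_of_none_mem (S := {none, x}) (by simp)
    (hG none x (some u) (some v) (by simpa using hu) (by simpa using hv))).mono ?_
  exact fun a b hab => ⟨hab.1, fun h => hab.2.1 (by simpa using h),
    fun h => hab.2.2 (by simpa using h)⟩

/-- A walk of `G` to `none` that avoids `x` and `y` reaches a neighbour of `none` inside `A`. A
cross edge leads from there to the side `B`, which is intact and connected because `H` without
`none` is. -/
lemma connOff_glue_inl (hG : ∀ x y, ConnOff G {x, y}) (hH : ∀ x y, ConnOff H {x, y})
    (hX : ∀ a, G.Adj none (some a) → ∃ b, X a b) (b₀ : B) (x y : A) :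
    ConnOff (glue G H X) {.inl x, .inl y} := by
  have hB : ∀ b b' : B, (del (glue G H X) {.inl x, .inl y}).Reachable (.inr b) (.inr b') :=
    fun b b' => reachable_glue_inr (T := {b | some b = none}) (by simp)
      (connOff_comap_some hH none b b' (by simp) (by simp))
  suffices h : ∀ u, u ∉ ({.inl x, .inl y} : Set (A ⊕ B)) →
      (del (glue G H X) {.inl x, .inl y}).Reachable u (.inr b₀) from
    fun u v hu hv => (h u hu).trans (h v hv).symm
  rintro (a | b) hu
  · obtain ⟨a', h1, h2, h3⟩ := exists_adj_none_of_reachable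
      (hG (some x) (some y) (some a) none (by simpa using hu) (by simp))
    obtain ⟨b, hb⟩ := hX a' h2
    refine (reachable_glue_inl (by simp) h3).trans
      (SimpleGraph.Reachable.trans (SimpleGraph.Adj.reachable ?_) (hB b b₀))
    exact ⟨hb, by simpa using h1, by simp⟩
  · exact hB b b₀

lemma del_comap_equiv {V V' : Type} (e : V ≃ V') (G : SimpleGraph V') (S : Set V') :
    del (G.comap e) (e ⁻¹' S) = (del G S).comap e := by
  ext x y; rfl

lemma connOff_comap_equiv {V V' : Type} (e : V ≃ V') (G : SimpleGraph V') (S : Set V') :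
    ConnOff (G.comap e) (e ⁻¹' S) ↔ ConnOff G S := by
  have : ∀ u v, (del (G.comap e) (e ⁻¹' S)).Reachable u v ↔ (del G S).Reachable (e u) (e v) := by
    intro u v
    rw [del_comap_equiv]
    exact (SimpleGraph.Iso.comap e (del G S)).reachable_iff.symm
  constructor
  · intro h u v hu hv
    have := (this (e.symm u) (e.symm v)).1 (h _ _ (by simpa using hu) (by simpa using hv))
    simpa using this
  · intro h u v hu hv
    exact (this u v).2 (h _ _ hu hv)

/-- If one vertex is deleted on each side, both sides stay connected, having lost only one vertex
besides `none`, and `hX₂` provides a surviving cross edge. Two deletions on the same side are the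
case of `connOff_glue_inl`. -/
theorem connOff_glue (hG : ∀ x y, ConnOff G {x, y}) (hH : ∀ x y, ConnOff H {x, y})
    (hX : ∀ a, G.Adj none (some a) → ∃ b, X a b) (hX' : ∀ b, H.Adj none (some b) → ∃ a, X a b)
    (hX₂ : ∀ x y, ∃ a b, a ≠ x ∧ b ≠ y ∧ X a b) [Nonempty A] [Nonempty B] (x y : A ⊕ B) :
    ConnOff (glue G H X) {x, y} := by
  have hmix : ∀ (x : A) (y : B), ConnOff (glue G H X) {.inl x, .inr y} := by
    intro x y
    obtain ⟨a₀, b₀, ha, hb, hab⟩ := hX₂ x y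
    have hadj : (del (glue G H X) {.inl x, .inr y}).Reachable (.inl a₀) (.inr b₀) :=
      SimpleGraph.Adj.reachable ⟨hab, by simpa using ha, by simpa using hb⟩
    suffices h : ∀ u, u ∉ ({.inl x, .inr y} : Set (A ⊕ B)) →
        (del (glue G H X) {.inl x, .inr y}).Reachable u (.inr b₀) from
      fun u v hu hv => (h u hu).trans (h v hv).symm
    rintro (a | b) hu
    · exact (reachable_glue_inl (T := {a | some a = some x}) (by simp)
        (connOff_comap_some hG (some x) a a₀ (by simpa using hu) (by simpa using ha))).trans hadj
    · exact reachable_glue_inr (T := {b | some b = some y}) (by simp)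
        (connOff_comap_some hH (some y) b b₀ (by simpa using hu) (by simpa using hb))
  rcases x with x | x <;> rcases y with y | y
  · exact connOff_glue_inl hG hH hX (Classical.arbitrary B) x y
  · exact hmix x y
  · rw [Set.pair_comm]; exact hmix y x
  · rw [← connOff_comap_equiv (Equiv.sumComm B A), glue_comap_swap]
    have := connOff_glue_inl (X := fun b a => X a b) hH hG hX' (Classical.arbitrary A) x y
    convert this using 1
    ext (z | z) <;> simp

end Glue

/-! ### Contractions of cycles -/

section Contraction

variable {V V' : Type}

lemma connected_map {C : SimpleGraph V} (hC : C.Connected) {f : V → V'} (hf : f.Surjective) :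
    (C.map f).Connected := by
  have := hC.nonempty.map f
  refine ⟨fun x y => ?_⟩
  obtain ⟨u, rfl⟩ := hf x
  obtain ⟨v, rfl⟩ := hf y
  obtain ⟨p⟩ := hC.preconnected u v
  induction p with
  | nil => rfl
  | @cons a b c hab p ih =>
    by_cases h : f a = f b
    · rw [h]; exact ih
    · exact SimpleGraph.Reachable.trans
        (SimpleGraph.Adj.reachable (SimpleGraph.map_adj_apply' hab h)) ih

lemma dg_map {C : SimpleGraph V} {f : V → V'} {u : V} (hu : ∀ v, f v = f u → v = u)
    (hinj : ∀ v v', C.Adj u v → C.Adj u v' → f v = f v' → v = v') :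
    dg (C.map f) (f u) = dg C u := by
  have hon : Set.InjOn f (C.neighborSet u) := fun v hv v' hv' h => hinj v v' hv hv' h
  rw [dg, dg, ← hon.ncard_image]
  congr 1
  ext x
  simp only [SimpleGraph.mem_neighborSet, Set.mem_image, SimpleGraph.map_adj']
  constructor
  · rintro ⟨-, u', v', h, h1, h2⟩
    rw [hu u' h1] at h
    exact ⟨v', h, h2⟩
  · rintro ⟨v, hv, rfl⟩
    exact ⟨fun h => hv.ne (hu v h.symm).symm, u, v, hv, rfl, rfl⟩

lemma dg_comap_some {A : Type} [Finite A] (C : SimpleGraph (Option A)) (a : A) :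
    (C.Adj (some a) none → dg (C.comap some) a + 1 = dg C (some a)) ∧
      (¬C.Adj (some a) none → dg (C.comap some) a = dg C (some a)) := by
  have him : some '' ((C.comap some).neighborSet a) = C.neighborSet (some a) \ {none} := by
    ext (_ | x) <;> simp
  have hn : dg (C.comap some) a = (C.neighborSet (some a) \ {none}).ncard := by
    rw [← him, Set.ncard_image_of_injective _ (Option.some_injective A)]
  refine ⟨fun h => ?_, fun h => ?_⟩
  · rw [hn]; exact Set.ncard_sdiff_singleton_add_one h
  · rw [hn]; exact congrArg _ (Set.sdiff_singleton_eq_self h)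

/-- Deleting a vertex of a cycle leaves a connected graph. -/
lemma IsHC.preconnected_comap_some {A : Type} [Finite A] {C : SimpleGraph (Option A)}
    (hC : IsHC C) : (C.comap some).Preconnected := by
  obtain ⟨p, q, hpq, hN⟩ := Set.ncard_eq_two.1 (hC.deg none)
  have hadj : ∀ x, C.Adj none x ↔ x = p ∨ x = q := fun x => by
    rw [← SimpleGraph.mem_neighborSet, hN]; simp
  obtain ⟨p, rfl⟩ : ∃ a, p = some a := Option.ne_none_iff_exists'.1
    fun h => C.irrefl (h ▸ (hadj p).2 (.inl rfl))
  obtain ⟨q, rfl⟩ : ∃ a, q = some a := Option.ne_none_iff_exists'.1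
    fun h => C.irrefl (h ▸ (hadj q).2 (.inr rfl))
  have hpq' : p ≠ q := fun h => hpq (h ▸ rfl)
  have key : ∀ a, (C.comap some).Reachable p a ∨ (C.comap some).Reachable q a := by
    intro a
    obtain ⟨a', -, h1, h2⟩ := exists_adj_none_of_reachable (G := C) (S := ∅) (a := a)
      ((hC.conn.preconnected _ _).mono fun _ _ h => ⟨h, id, id⟩)
    have h3 : (C.comap some).Reachable a' a := h2.symm.mono fun x y (h : (del (C.comap some) _).Adj x y) => h.1
    rcases (hadj _).1 h1 with h | h <;> rw [Option.some.inj h] at h3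
    · exact .inl h3
    · exact .inr h3
  -- Otherwise the component of `p` has a single vertex of odd degree, namely `p` with degree one.
  -- `K` keeps just the edges of that component.
  have hreach : (C.comap some).Reachable p q := by
    by_contra hcon
    let K : SimpleGraph A :=
      { Adj := fun a b => C.Adj (some a) (some b) ∧ (C.comap some).Reachable p a
        symm.symm := fun a b h => ⟨h.1.symm, h.2.trans (SimpleGraph.Adj.reachable h.1)⟩
        loopless.irrefl := fun a h => C.irrefl h.1 }
    have hK : ∀ a, (C.comap some).Reachable p a → dg K a = dg (C.comap some) a := by
      intro a ha
      rw [dg, dg]; congr 1; ext b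
      exact and_iff_left ha
    have hK0 : ∀ a, ¬(C.comap some).Reachable p a → dg K a = 0 := by
      intro a ha
      rw [dg, Set.ncard_eq_zero]
      ext b
      simp only [SimpleGraph.mem_neighborSet, Set.mem_empty_iff_false, iff_false]
      exact fun h => ha h.2
    have h1 : Even (dg K p) := by
      refine even_dg_of_forall_ne K p fun v hv => ?_
      by_cases hr : (C.comap some).Reachable p v
      · rw [hK v hr, (dg_comap_some C v).2, hC.deg]
        · decide
        · intro h
          rcases (hadj _).1 h.symm with h | h
          · exact hv (Option.some.inj h)
          · exact hcon (Option.some.inj h ▸ hr)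
      · rw [hK0 v hr]; decide
    have h2 := (dg_comap_some C p).1 ((hadj _).2 (.inl rfl)).symm
    rw [hC.deg, ← hK p .rfl] at h2
    rw [show dg K p = 1 by omega] at h1
    exact absurd h1 (by decide)
  have hp : ∀ a, (C.comap some).Reachable p a := fun a => (key a).elim id hreach.trans
  exact fun a b => (hp a).symm.trans (hp b)

end Contraction

/-! ### Hamiltonian cycles of a gluing -/

section UniqueGlue

variable {A B : Type}

/-- The edges joining the two sides of a gluing. -/
def cross (a₀ a₁ w : A) (b₀ b₁ : B) (W : Set B) (a : A) (b : B) : Prop :=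
  (a = a₀ ∧ b = b₀) ∨ (a = a₁ ∧ b = b₁) ∨ (a = w ∧ b ∈ W)

/-- `none` has the three neighbours `a₀`, `a₁`, `w` in `G`, and it has the neighbours `b₀`, `b₁`
and the vertices of `W` in `H`. -/
structure Socket (G : SimpleGraph (Option A)) (H : SimpleGraph (Option B)) (a₀ a₁ w : A)
    (b₀ b₁ : B) (W : Set B) : Prop where
  a₀₁ : a₀ ≠ a₁
  a₀w : a₀ ≠ w
  a₁w : a₁ ≠ w
  b₀₁ : b₀ ≠ b₁
  b₀W : b₀ ∉ W
  b₁W : b₁ ∉ W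
  hG : ∀ a, G.Adj none (some a) ↔ a = a₀ ∨ a = a₁ ∨ a = w
  hH : ∀ b, H.Adj none (some b) ↔ b = b₀ ∨ b = b₁ ∨ b ∈ W

/-- `H` with its vertex `none` split into one vertex adjacent to `b₀` and `b₁` and one adjacent to
the vertices of `W`. -/
def splitNone (H : SimpleGraph (Option B)) (b₀ b₁ : B) (W : Set B) :
    SimpleGraph (Option (Option B)) where
  Adj
    | some (some b), some (some b') => H.Adj (some b) (some b')
    | none, some (some b) => b = b₀ ∨ b = b₁
    | some (some b), none => b = b₀ ∨ b = b₁
    | some none, some (some b) => b ∈ W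
    | some (some b), some none => b ∈ W
    | _, _ => False
  symm.symm x y h := by
    rcases x with _ | _ | x <;> rcases y with _ | _ | y <;> first
      | exact h
      | exact SimpleGraph.Adj.symm (G := H) h
  loopless.irrefl x h := by
    rcases x with _ | _ | x
    · exact h
    · exact h
    · exact H.irrefl h

variable {G : SimpleGraph (Option A)} {H : SimpleGraph (Option B)} {a₀ a₁ w : A} {b₀ b₁ : B}
  {W : Set B}

lemma Socket.conn (s : Socket G H a₀ a₁ w b₀ b₁ W) (hW : W.Nonempty) (hG : ∀ x y, ConnOff G {x, y})
    (hH : ∀ x y, ConnOff H {x, y}) (x y : A ⊕ B) :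
    ConnOff (glue G H (cross a₀ a₁ w b₀ b₁ W)) {x, y} := by
  have : Nonempty A := ⟨a₀⟩
  have : Nonempty B := ⟨b₀⟩
  obtain ⟨β, hβ⟩ := hW
  have h0 : cross a₀ a₁ w b₀ b₁ W a₀ b₀ := .inl ⟨rfl, rfl⟩
  have h1 : cross a₀ a₁ w b₀ b₁ W a₁ b₁ := .inr (.inl ⟨rfl, rfl⟩)
  have h2 : ∀ b ∈ W, cross a₀ a₁ w b₀ b₁ W w b := fun b hb => .inr (.inr ⟨rfl, hb⟩)
  have e1 := s.a₀₁
  have e2 := s.a₀w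
  have e3 := s.a₁w
  have e4 := s.b₀₁
  have e5 : β ≠ b₀ := fun h => s.b₀W (h ▸ hβ)
  have e6 : β ≠ b₁ := fun h => s.b₁W (h ▸ hβ)
  refine connOff_glue hG hH ?_ ?_ ?_ x y
  · intro a ha
    rcases (s.hG a).1 ha with rfl | rfl | rfl
    exacts [⟨_, h0⟩, ⟨_, h1⟩, ⟨_, h2 β hβ⟩]
  · intro b hb
    rcases (s.hH b).1 hb with rfl | rfl | hb
    exacts [⟨_, h0⟩, ⟨_, h1⟩, ⟨_, h2 b hb⟩]
  · intro x y
    by_cases hx0 : a₀ ≠ x ∧ b₀ ≠ y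
    · exact ⟨a₀, b₀, hx0.1, hx0.2, h0⟩
    by_cases hx1 : a₁ ≠ x ∧ b₁ ≠ y
    · exact ⟨a₁, b₁, hx1.1, hx1.2, h1⟩
    -- Here `x` and `y` meet both of the disjoint edges `a₀ b₀` and `a₁ b₁`. So `x` is `a₀` or `a₁`,
    -- `y` is `b₀` or `b₁`, and the edge from `w` to `β` is untouched.
    refine ⟨w, β, ?_, ?_, h2 β hβ⟩ <;> grind

/-- The part on the side of `G` of a subgraph of a gluing; the other side becomes `none`. -/
def resL (C : SimpleGraph (A ⊕ B)) : SimpleGraph (Option A) := C.map (Sum.elim some fun _ => none)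

/-- The part on the side of `H` of a subgraph of a gluing; the other side becomes `none`. -/
def resR (C : SimpleGraph (A ⊕ B)) : SimpleGraph (Option B) := C.map (Sum.elim (fun _ => none) some)

lemma resL_some_some (C : SimpleGraph (A ⊕ B)) (a a' : A) :
    (resL C).Adj (some a) (some a') ↔ C.Adj (.inl a) (.inl a') := by
  simp only [resL, SimpleGraph.map_adj']
  constructor
  · rintro ⟨-, u | u, v | v, h, h1, h2⟩ <;> simp at h1 h2
    exact h1 ▸ h2 ▸ h
  · intro h
    exact ⟨fun e => h.ne (by rw [Option.some.inj e]), _, _, h, rfl, rfl⟩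

lemma resL_none_some (C : SimpleGraph (A ⊕ B)) (a : A) :
    (resL C).Adj none (some a) ↔ ∃ b, C.Adj (.inl a) (.inr b) := by
  simp only [resL, SimpleGraph.map_adj']
  constructor
  · rintro ⟨-, u | u, v | v, h, h1, h2⟩ <;> simp at h1 h2
    exact ⟨u, h2 ▸ h.symm⟩
  · rintro ⟨b, h⟩
    exact ⟨by simp, _, _, h.symm, rfl, rfl⟩

lemma resR_some_some (C : SimpleGraph (A ⊕ B)) (b b' : B) :
    (resR C).Adj (some b) (some b') ↔ C.Adj (.inr b) (.inr b') := by
  simp only [resR, SimpleGraph.map_adj']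
  constructor
  · rintro ⟨-, u | u, v | v, h, h1, h2⟩ <;> simp at h1 h2
    exact h1 ▸ h2 ▸ h
  · intro h
    exact ⟨fun e => h.ne (by rw [Option.some.inj e]), _, _, h, rfl, rfl⟩

lemma resR_none_some (C : SimpleGraph (A ⊕ B)) (b : B) :
    (resR C).Adj none (some b) ↔ ∃ a, C.Adj (.inl a) (.inr b) := by
  simp only [resR, SimpleGraph.map_adj']
  constructor
  · rintro ⟨-, u | u, v | v, h, h1, h2⟩ <;> simp at h1 h2
    exact ⟨u, h2 ▸ h⟩
  · rintro ⟨b, h⟩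
    exact ⟨by simp, _, _, h, rfl, rfl⟩

lemma Socket.resL_le {C : SimpleGraph (A ⊕ B)} (s : Socket G H a₀ a₁ w b₀ b₁ W)
    (hle : C ≤ glue G H (cross a₀ a₁ w b₀ b₁ W)) : resL C ≤ G := by
  have hn : ∀ a, (resL C).Adj none (some a) → G.Adj none (some a) := by
    intro a h
    obtain ⟨b, hb⟩ := (resL_none_some C a).1 h
    have hb' : cross a₀ a₁ w b₀ b₁ W a b := hle hb
    rcases hb' with h | h | h
    · exact (s.hG a).2 (.inl h.1)
    · exact (s.hG a).2 (.inr (.inl h.1))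
    · exact (s.hG a).2 (.inr (.inr h.1))
  rintro (_ | a) (_ | a') h
  · exact absurd h (resL C).irrefl
  · exact hn a' h
  · exact (hn a h.symm).symm
  · exact hle ((resL_some_some C a a').1 h)

lemma Socket.resR_le {C : SimpleGraph (A ⊕ B)} (s : Socket G H a₀ a₁ w b₀ b₁ W)
    (hle : C ≤ glue G H (cross a₀ a₁ w b₀ b₁ W)) : resR C ≤ H := by
  have hn : ∀ b, (resR C).Adj none (some b) → H.Adj none (some b) := by
    intro b h
    obtain ⟨a, hb⟩ := (resR_none_some C b).1 h
    have hb' : cross a₀ a₁ w b₀ b₁ W a b := hle hb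
    rcases hb' with h | h | h
    · exact (s.hH b).2 (.inl h.2)
    · exact (s.hH b).2 (.inr (.inl h.2))
    · exact (s.hH b).2 (.inr (.inr h.2))
  rintro (_ | a) (_ | a') h
  · exact absurd h (resR C).irrefl
  · exact hn a' h
  · exact (hn a h.symm).symm
  · exact hle ((resR_some_some C a a').1 h)

lemma Socket.cross_left {C : SimpleGraph (A ⊕ B)} (s : Socket G H a₀ a₁ w b₀ b₁ W)
    (hle : C ≤ glue G H (cross a₀ a₁ w b₀ b₁ W))
    {a a' : A} {b : B} (h : C.Adj (.inl a) (.inr b))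
    (h' : C.Adj (.inl a') (.inr b)) : a = a' := by
  have e1 := s.b₀₁
  have e2 := s.b₀W
  have e3 := s.b₁W
  have h1 : cross a₀ a₁ w b₀ b₁ W a b := hle h
  have h2 : cross a₀ a₁ w b₀ b₁ W a' b := hle h'
  rcases h1 with ⟨rfl, rfl⟩ | ⟨rfl, rfl⟩ | ⟨rfl, h1⟩ <;>
    rcases h2 with ⟨rfl, h2⟩ | ⟨rfl, h2⟩ | ⟨rfl, h2⟩ <;> first | rfl | grind

lemma Socket.cross_right {C : SimpleGraph (A ⊕ B)} (s : Socket G H a₀ a₁ w b₀ b₁ W)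
    (hle : C ≤ glue G H (cross a₀ a₁ w b₀ b₁ W))
    {a : A} {b b' : B} (hw : a ≠ w) (h : C.Adj (.inl a) (.inr b))
    (h' : C.Adj (.inl a) (.inr b')) : b = b' := by
  have e1 := s.a₀₁
  have h1 : cross a₀ a₁ w b₀ b₁ W a b := hle h
  have h2 : cross a₀ a₁ w b₀ b₁ W a b' := hle h'
  rcases h1 with ⟨rfl, rfl⟩ | ⟨rfl, rfl⟩ | ⟨rfl, h1⟩ <;>
    rcases h2 with ⟨h3, h2⟩ | ⟨h3, h2⟩ | ⟨h3, h2⟩ <;> first | rfl | grind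

/-- If `C` had two edges from `w` to `W`, these would be all its edges at `w`, so the other vertices
of `A` would be attached only through `b₀` and `b₁`. Contracting them to one vertex, with `w` kept
apart, would give a hamiltonian cycle of `splitNone H b₀ b₁ W`. -/
lemma Socket.hub_unique [Finite A] [Finite B] {C : SimpleGraph (A ⊕ B)} (s : Socket G H a₀ a₁ w b₀ b₁ W)
    (hle : C ≤ glue G H (cross a₀ a₁ w b₀ b₁ W))
    (hC : IsHC C) (hsplit : ∀ D ≤ splitNone H b₀ b₁ W, ¬IsHC D) {β β' : B}
    (h : C.Adj (.inl w) (.inr β)) (h' : C.Adj (.inl w) (.inr β')) : β = β' := by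
  classical
  by_contra hne
  have hN : C.neighborSet (.inl w) = {.inr β, .inr β'} := by
    symm
    apply Set.eq_of_subset_of_ncard_le
    · rintro x (rfl | rfl)
      exacts [h, h']
    · have := hC.deg (.inl w)
      rw [dg] at this
      rw [this, Set.ncard_pair (by simpa using hne)]
    · exact Set.toFinite _
  have hNadj : ∀ x, C.Adj (.inl w) x → ∃ b, x = .inr b := by
    intro x hx
    have : x ∈ C.neighborSet (.inl w) := hx
    rw [hN] at this
    rcases this with rfl | rfl
    exacts [⟨_, rfl⟩, ⟨_, rfl⟩]
  let f : A ⊕ B → Option (Option B) :=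
    Sum.elim (fun a => if a = w then some none else none) fun b => some (some b)
  have f1 : ∀ b, f (.inr b) = some (some b) := fun b => rfl
  have f2 : f (.inl w) = some none := by simp [f]
  have f3 : ∀ a, a ≠ w → f (.inl a) = none := fun a ha => by simp [f, ha]
  have f4 : ∀ x b, f x = some (some b) → x = .inr b := by
    rintro (a | b') b hx
    · by_cases ha : a = w
      · subst ha; rw [f2] at hx; simp at hx
      · rw [f3 a ha] at hx; simp at hx
    · simpa [f] using hx
  have f5 : ∀ x, f x = some none → x = .inl w := by
    rintro (a | b') hx
    · by_cases ha : a = w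
      · rw [ha]
      · rw [f3 a ha] at hx; simp at hx
    · simp [f] at hx
  have f6 : ∀ x, f x = none → ∃ a, a ≠ w ∧ x = .inl a := by
    rintro (a | b') hx
    · by_cases ha : a = w
      · subst ha; rw [f2] at hx; simp at hx
      · exact ⟨a, ha, rfl⟩
    · simp [f] at hx
  have hle' : C.map f ≤ splitNone H b₀ b₁ W := by
    have hone : ∀ u v, C.Adj u v → f u ≠ f v → (splitNone H b₀ b₁ W).Adj (f u) (f v) := by
      have hcr : ∀ a b, C.Adj (.inl a) (.inr b) →
          (splitNone H b₀ b₁ W).Adj (f (.inl a)) (f (.inr b)) := by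
        intro a b hab
        have hx : cross a₀ a₁ w b₀ b₁ W a b := hle hab
        rcases hx with ⟨rfl, rfl⟩ | ⟨rfl, rfl⟩ | ⟨rfl, hx⟩
        · rw [f3 _ s.a₀w, f1]; exact .inl rfl
        · rw [f3 _ s.a₁w, f1]; exact .inr rfl
        · rw [f2, f1]; exact hx
      rintro (a | b) (a' | b') huv hne
      · exfalso
        by_cases ha : a = w
        · subst ha
          obtain ⟨b, hb⟩ := hNadj _ huv
          simp at hb
        · by_cases ha' : a' = w
          · subst ha'
            obtain ⟨b, hb⟩ := hNadj _ huv.symm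
            simp at hb
          · exact hne (by rw [f3 a ha, f3 a' ha'])
      · exact hcr _ _ huv
      · exact (hcr _ _ huv.symm).symm
      · exact hle huv
    rintro x y ⟨hxy, u, v, huv, rfl, rfl⟩
    exact hone u v huv hxy
  refine hsplit _ hle' (dg_eq_two_of_conn (connected_map hC.conn ?_) none ?_ ?_)
  · rintro (_ | _ | b)
    exacts [⟨_, f3 _ s.a₀w⟩, ⟨_, f2⟩, ⟨_, f1 b⟩]
  · rintro (_ | _ | b) hx
    · exact absurd rfl hx
    · rw [← f2, dg_map, hC.deg]
      · intro v hv; rw [f2] at hv; exact f5 v hv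
      · intro v v' hv hv' hvv
        obtain ⟨b, rfl⟩ := hNadj _ hv
        exact (f4 v' b hvv.symm).symm
    · rw [← f1 b, dg_map, hC.deg]
      · intro v hv; rw [f1] at hv; exact f4 v b hv
      · rintro (a | c) (a' | c') hv hv' hvv
        · rw [s.cross_left hle hv.symm hv'.symm]
        · exact f4 _ _ (hvv.trans (f1 c'))
        · exact (f4 _ _ (hvv.symm.trans (f1 c))).symm
        · exact f4 _ _ (hvv.trans (f1 c'))
  · refine le_trans (Set.ncard_le_ncard (t := {some (some b₀), some (some b₁)}) ?_ (Set.toFinite _))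
      (le_trans (Set.ncard_insert_le _ _) (by simp))
    rintro (_ | _ | b) hx
    · exact absurd hx (C.map f).irrefl
    · exact absurd (hle' hx) id
    · rcases (hle' hx : b = b₀ ∨ b = b₁) with rfl | rfl <;> simp

/-- No vertex of `A` has two cross edges in `C`, so contracting `B` merges no edges and degrees in
`A` stay two. The contracted vertex has at most the three neighbours `a₀`, `a₁`, `w`, and parity
does the rest. -/
lemma Socket.isHC_resL [Finite A] {C : SimpleGraph (A ⊕ B)} (s : Socket G H a₀ a₁ w b₀ b₁ W)
    (hle : C ≤ glue G H (cross a₀ a₁ w b₀ b₁ W))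
    (hC : IsHC C)
    (huniq : ∀ β β', C.Adj (.inl w) (.inr β) → C.Adj (.inl w) (.inr β') → β = β') : IsHC (resL C) := by
  have : Nontrivial (Option A) := ⟨none, some a₀, by simp⟩
  refine dg_eq_two_of_conn (connected_map hC.conn ?_) none ?_ ?_
  · rintro (_ | a)
    exacts [⟨.inr b₀, rfl⟩, ⟨.inl a, rfl⟩]
  · rintro (_ | a) hx
    · exact absurd rfl hx
    · rw [show some a = (Sum.elim some fun _ => none : A ⊕ B → Option A) (.inl a) from rfl, resL,
        dg_map, hC.deg]
      · rintro (v | v) hv <;> simp at hv ⊢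
        exact hv
      · rintro (v | v) (v' | v') hv hv' hvv <;> simp at hvv ⊢
        · exact hvv
        · by_cases ha : a = w
          · exact huniq _ _ (ha ▸ hv) (ha ▸ hv')
          · exact s.cross_right hle ha hv hv'
  · refine le_trans (Set.ncard_le_ncard (t := {some a₀, some a₁, some w}) ?_ (Set.toFinite _))
      (le_trans (Set.ncard_insert_le _ _) (Nat.succ_le_succ
        (le_trans (Set.ncard_insert_le _ _) (by simp))))
    rintro (_ | a) hx
    · exact absurd hx (resL C).irrefl
    · rcases (s.hG a).1 (s.resL_le hle hx) with rfl | rfl | rfl <;> simp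

lemma Socket.isHC_resR [Finite B] {C : SimpleGraph (A ⊕ B)} (s : Socket G H a₀ a₁ w b₀ b₁ W)
    (hle : C ≤ glue G H (cross a₀ a₁ w b₀ b₁ W))
    (hC : IsHC C)
    (huniq : ∀ β β', C.Adj (.inl w) (.inr β) → C.Adj (.inl w) (.inr β') → β = β') : IsHC (resR C) := by
  have : Nontrivial (Option B) := ⟨none, some b₀, by simp⟩
  refine dg_eq_two_of_conn (connected_map hC.conn ?_) none ?_ ?_
  · rintro (_ | a)
    exacts [⟨.inl a₀, rfl⟩, ⟨.inr a, rfl⟩]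
  · rintro (_ | a) hx
    · exact absurd rfl hx
    · rw [show some a = (Sum.elim (fun _ => none) some : A ⊕ B → Option B) (.inr a) from rfl, resR,
        dg_map, hC.deg]
      · rintro (v | v) hv <;> simp at hv ⊢
        exact hv
      · rintro (v | v) (v' | v') hv hv' hvv <;> simp at hvv ⊢
        · exact s.cross_left hle hv.symm hv'.symm
        · exact hvv
  -- `W` may be large, but at most one edge of `C` runs from `w` to it. So the contracted vertex
  -- again has degree at most three.
  · have hsub : (resR C).neighborSet none ⊆
        {some b₀, some b₁} ∪ some '' {β | C.Adj (.inl w) (.inr β)} := by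
      rintro (_ | b) hx
      · exact absurd hx (resR C).irrefl
      · obtain ⟨a, ha⟩ := (resR_none_some C b).1 hx
        have hx : cross a₀ a₁ w b₀ b₁ W a b := hle ha
        rcases hx with ⟨rfl, rfl⟩ | ⟨rfl, rfl⟩ | ⟨rfl, -⟩
        · simp
        · simp
        · exact .inr ⟨b, ha, rfl⟩
    refine le_trans (Set.ncard_le_ncard hsub (Set.toFinite _)) (le_trans (Set.ncard_union_le _ _) ?_)
    have h1 : ({some b₀, some b₁} : Set (Option B)).ncard ≤ 2 :=
      le_trans (Set.ncard_insert_le _ _) (by simp)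
    have h2 : (some '' {β | C.Adj (.inl w) (.inr β)}).ncard ≤ 1 := by
      refine le_trans (Set.ncard_image_le (Set.toFinite _)) ?_
      rw [Set.ncard_le_one]
      exact fun x hx y hy => huniq x y hx hy
    omega

lemma Socket.resL_a₀ {C : SimpleGraph (A ⊕ B)} (s : Socket G H a₀ a₁ w b₀ b₁ W)
    (hle : C ≤ glue G H (cross a₀ a₁ w b₀ b₁ W)) : (resL C).Adj none (some a₀) ↔ (resR C).Adj none (some b₀) := by
  rw [resL_none_some, resR_none_some]
  have e1 := s.a₀₁
  have e2 := s.a₀w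
  have e3 := s.b₀₁
  have e4 := s.b₀W
  constructor
  · rintro ⟨b, hb⟩
    rcases (hle hb : cross a₀ a₁ w b₀ b₁ W a₀ b) with ⟨-, rfl⟩ | ⟨h, -⟩ | ⟨h, -⟩
    exacts [⟨_, hb⟩, absurd h e1, absurd h e2]
  · rintro ⟨a, ha⟩
    rcases (hle ha : cross a₀ a₁ w b₀ b₁ W a b₀) with ⟨rfl, -⟩ | ⟨-, h⟩ | ⟨-, h⟩
    exacts [⟨_, ha⟩, absurd h e3, absurd h e4]

lemma Socket.resL_a₁ {C : SimpleGraph (A ⊕ B)} (s : Socket G H a₀ a₁ w b₀ b₁ W)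
    (hle : C ≤ glue G H (cross a₀ a₁ w b₀ b₁ W)) : (resL C).Adj none (some a₁) ↔ (resR C).Adj none (some b₁) := by
  rw [resL_none_some, resR_none_some]
  have e1 := s.a₀₁
  have e2 := s.a₁w
  have e3 := s.b₀₁
  have e4 := s.b₁W
  constructor
  · rintro ⟨b, hb⟩
    rcases (hle hb : cross a₀ a₁ w b₀ b₁ W a₁ b) with ⟨h, -⟩ | ⟨-, rfl⟩ | ⟨h, -⟩
    exacts [absurd h.symm e1, ⟨_, hb⟩, absurd h e2]
  · rintro ⟨a, ha⟩
    rcases (hle ha : cross a₀ a₁ w b₀ b₁ W a b₁) with ⟨-, h⟩ | ⟨rfl, -⟩ | ⟨-, h⟩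
    exacts [absurd h.symm e3, ⟨_, ha⟩, absurd h e4]

lemma Socket.resL_w {C : SimpleGraph (A ⊕ B)} (s : Socket G H a₀ a₁ w b₀ b₁ W)
    (hle : C ≤ glue G H (cross a₀ a₁ w b₀ b₁ W))
    {b : B} (hb : b ∈ W) (h : (resR C).Adj none (some b)) :
    (resL C).Adj none (some w) := by
  obtain ⟨a, ha⟩ := (resR_none_some C b).1 h
  rw [resL_none_some]
  rcases (hle ha : cross a₀ a₁ w b₀ b₁ W a b) with ⟨-, rfl⟩ | ⟨-, rfl⟩ | ⟨rfl, -⟩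
  exacts [absurd hb s.b₀W, absurd hb s.b₁W, ⟨_, ha⟩]

lemma adj_two {V : Type} [Finite V] {C : SimpleGraph V} {v x y : V} (hv : dg C v = 2)
    (h : ∀ u, C.Adj v u → u = x ∨ u = y) (hxy : x ≠ y) :
    ∀ u, C.Adj v u ↔ u = x ∨ u = y := by
  have hN : C.neighborSet v = {x, y} := by
    apply Set.eq_of_subset_of_ncard_le
    · exact h
    · rw [Set.ncard_pair hxy]; exact hv.ge
    · exact Set.toFinite _
  intro u
  rw [← SimpleGraph.mem_neighborSet, hN]; rfl

/-- Without `none`, the two cycles become paths with ends `a₀`, `a₁` and `b₀`, `b₁`; the first two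
cross edges close them to one cycle. -/
lemma Socket.isHC_glue [Finite A] [Finite B] (s : Socket G H a₀ a₁ w b₀ b₁ W)
    {C₁ : SimpleGraph (Option A)} {C₂ : SimpleGraph (Option B)}
    (h1 : C₁ ≤ G) (hC1 : IsHC C₁) (hw : ¬C₁.Adj none (some w))
    (h2 : C₂ ≤ H) (hC2 : IsHC C₂) (hW : ∀ b ∈ W, ¬C₂.Adj none (some b)) :
    IsHC (glue C₁ C₂ (cross a₀ a₁ w b₀ b₁ ∅)) := by
  classical
  have hn1 : ∀ a, C₁.Adj none (some a) ↔ a = a₀ ∨ a = a₁ := by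
    have := adj_two (x := some a₀) (y := some a₁) (hC1.deg none) ?_ (by simpa using s.a₀₁)
    · intro a; simpa using this (some a)
    rintro (_ | a) h
    · exact absurd h C₁.irrefl
    · rcases (s.hG a).1 (h1 h) with rfl | rfl | rfl
      · simp
      · simp
      · exact absurd h hw
  have hn2 : ∀ b, C₂.Adj none (some b) ↔ b = b₀ ∨ b = b₁ := by
    have := adj_two (x := some b₀) (y := some b₁) (hC2.deg none) ?_ (by simpa using s.b₀₁)
    · intro b; simpa using this (some b)
    rintro (_ | b) h
    · exact absurd h C₂.irrefl
    · rcases (s.hH b).1 (h2 h) with rfl | rfl | hb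
      · simp
      · simp
      · exact absurd h (hW b hb)
  have e1 := s.a₀₁
  have e2 := s.b₀₁
  have hcr : ∀ a b, cross a₀ a₁ w b₀ b₁ ∅ a b ↔ (a = a₀ ∧ b = b₀) ∨ (a = a₁ ∧ b = b₁) := by
    intro a b; simp [cross]
  constructor
  · have hl : ∀ a a', (glue C₁ C₂ (cross a₀ a₁ w b₀ b₁ ∅)).Reachable (.inl a) (.inl a') :=
      fun a a' => (hC1.preconnected_comap_some a a').map
        (⟨Sum.inl, fun {_ _} h => h⟩ : C₁.comap some →g _)
    have hr : ∀ b b', (glue C₁ C₂ (cross a₀ a₁ w b₀ b₁ ∅)).Reachable (.inr b) (.inr b') :=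
      fun b b' => (hC2.preconnected_comap_some b b').map
        (⟨Sum.inr, fun {_ _} h => h⟩ : C₂.comap some →g _)
    have h0 : (glue C₁ C₂ (cross a₀ a₁ w b₀ b₁ ∅)).Reachable (.inl a₀) (.inr b₀) :=
      SimpleGraph.Adj.reachable ((hcr _ _).2 (.inl ⟨rfl, rfl⟩))
    have h : ∀ x, (glue C₁ C₂ (cross a₀ a₁ w b₀ b₁ ∅)).Reachable x (.inl a₀) := by
      rintro (a | b)
      · exact hl _ _
      · exact (hr _ _).trans h0.symm
    have : Nonempty (A ⊕ B) := ⟨.inl a₀⟩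
    exact ⟨fun x y => (h x).trans (h y).symm⟩
  · rintro (a | b)
    · rw [dg_glue_inl (b := if a = a₀ then b₀ else b₁), hC1.deg]
      intro b'
      rw [hcr, C₁.adj_comm, hn1]
      split_ifs <;> grind
    · rw [dg_glue_inr (a := if b = b₀ then a₀ else a₁), hC2.deg]
      intro b'
      rw [hcr, C₂.adj_comm, hn2]
      split_ifs <;> grind

lemma dg_ge_three {V : Type} [Finite V] {C : SimpleGraph V} {v x y z : V} (hx : C.Adj v x)
    (hy : C.Adj v y) (hz : C.Adj v z) (hxy : x ≠ y) (hxz : x ≠ z) (hyz : y ≠ z) : 3 ≤ dg C v := by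
  have : ({x, y, z} : Set V) ⊆ C.neighborSet v := by
    rintro u (rfl | rfl | rfl) <;> assumption
  rw [← Set.ncard_eq_three.2 ⟨x, y, z, hxy, hxz, hyz, rfl⟩]
  exact Set.ncard_le_ncard this (Set.toFinite _)

/-- Neither side need be uniquely hamiltonian. The edge `a₀ b₀` is seen in both restrictions of a
cycle, so it is enough that one of the sides forces it, and likewise for `a₁ b₁`. Once both are
forced, the restriction to `G` already has degree two at `none`, no edge from `w` to `W` is used,
and `hu1` and `hu2` apply. -/
theorem Socket.uniqueHC [Finite A] [Finite B] (s : Socket G H a₀ a₁ w b₀ b₁ W)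
    (hsplit : ∀ D ≤ splitNone H b₀ b₁ W, ¬IsHC D)
    {C₁ : SimpleGraph (Option A)} {C₂ : SimpleGraph (Option B)}
    (h1 : C₁ ≤ G) (hC1 : IsHC C₁) (hw : ¬C₁.Adj none (some w))
    (hu1 : ∀ C ≤ G, IsHC C → ¬C.Adj none (some w) → C = C₁)
    (h2 : C₂ ≤ H) (hC2 : IsHC C₂) (hW : ∀ b ∈ W, ¬C₂.Adj none (some b))
    (hu2 : ∀ C ≤ H, IsHC C → (∀ b ∈ W, ¬C.Adj none (some b)) → C = C₂)
    (he0 : ∀ C ≤ G, ∀ D ≤ H, IsHC C → IsHC D → ¬C.Adj none (some a₀) → D.Adj none (some b₀))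
    (he1 : ∀ C ≤ G, ∀ D ≤ H, IsHC C → IsHC D → ¬C.Adj none (some a₁) → D.Adj none (some b₁)) :
    UniqueHC (glue G H (cross a₀ a₁ w b₀ b₁ W)) (glue C₁ C₂ (cross a₀ a₁ w b₀ b₁ ∅)) := by
  refine ⟨⟨?_, s.isHC_glue h1 hC1 hw h2 hC2 hW⟩, fun C hle hC => ?_⟩
  · rintro (a | b) (a' | b') h
    · exact h1 h
    · exact h.imp_right fun h => h.imp_right fun h => ⟨h.1, h.2.elim⟩
    · exact Or.imp_right (fun h => h.imp_right fun h => ⟨h.1, h.2.elim⟩) h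
    · exact h2 h
  have huniq := fun β β' => s.hub_unique hle hC hsplit (β := β) (β' := β')
  have hL := s.isHC_resL hle hC huniq
  have hR := s.isHC_resR hle hC huniq
  have hLle := s.resL_le hle
  have hRle := s.resR_le hle
  have ha0 : (resL C).Adj none (some a₀) := by
    by_contra h
    exact h ((s.resL_a₀ hle).2 (he0 _ hLle _ hRle hL hR h))
  have ha1 : (resL C).Adj none (some a₁) := by
    by_contra h
    exact h ((s.resL_a₁ hle).2 (he1 _ hLle _ hRle hL hR h))
  have haw : ¬(resL C).Adj none (some w) := fun h => by
    have := dg_ge_three ha0 ha1 h (by simpa using s.a₀₁) (by simpa using s.a₀w)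
      (by simpa using s.a₁w)
    rw [hL.deg] at this
    omega
  have hLC := hu1 _ hLle hL haw
  have hRC := hu2 _ hRle hR fun b hb h => haw (s.resL_w hle hb h)
  have hcr : ∀ a b, C.Adj (.inl a) (.inr b) ↔ cross a₀ a₁ w b₀ b₁ ∅ a b := by
    intro a b
    constructor
    · intro h
      rcases (hle h : cross a₀ a₁ w b₀ b₁ W a b) with h' | h' | ⟨rfl, -⟩
      · exact .inl h'
      · exact .inr (.inl h')
      · exact absurd ((resL_none_some C _).2 ⟨b, h⟩) haw
    · rintro (⟨rfl, rfl⟩ | ⟨rfl, rfl⟩ | ⟨-, h⟩)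
      · obtain ⟨b, hb⟩ := (resL_none_some C _).1 ha0
        rcases (hle hb : cross _ a₁ w _ b₁ W _ b) with ⟨-, rfl⟩ | ⟨h, -⟩ | ⟨h, -⟩
        exacts [hb, absurd h s.a₀₁, absurd h s.a₀w]
      · obtain ⟨b, hb⟩ := (resL_none_some C _).1 ha1
        rcases (hle hb : cross a₀ _ w b₀ _ W _ b) with ⟨h, -⟩ | ⟨-, rfl⟩ | ⟨h, -⟩
        exacts [absurd h.symm s.a₀₁, hb, absurd h s.a₁w]
      · exact h.elim
  ext (a | b) (a' | b')
  · rw [glue_inl_inl, ← hLC, resL_some_some]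
  · rw [glue_inl_inr, hcr]
  · rw [glue_inr_inl, C.adj_comm, hcr]
  · rw [glue_inr_inr, ← hRC, resR_some_some]

/-- If `W` has a single vertex, the split graph has a vertex of degree one. -/
lemma not_isHC_splitNone_singleton [Finite B] (H : SimpleGraph (Option B)) (b₀ b₁ b₂ : B) :
    ∀ D ≤ splitNone H b₀ b₁ {b₂}, ¬IsHC D := by
  intro D hD h
  have h1 := h.deg (some none)
  have : D.neighborSet (some none) ⊆ {some (some b₂)} := by
    rintro (_ | _ | b) hb
    · exact (hD hb).elim
    · exact (hD hb).elim
    · have : b ∈ ({b₂} : Set B) := hD hb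
      rw [Set.mem_singleton_iff.1 this]; rfl
  have h2 := Set.ncard_le_ncard this (Set.toFinite _)
  rw [Set.ncard_singleton] at h2
  rw [dg] at h1
  omega

/-- The version of `Socket.uniqueHC` for a uniquely hamiltonian graph on the left. -/
theorem Socket.uniqueHC_of_uniqueHC [Finite A] [Finite B] (s : Socket G H a₀ a₁ w b₀ b₁ W)
    (hsplit : ∀ D ≤ splitNone H b₀ b₁ W, ¬IsHC D)
    {C₁ : SimpleGraph (Option A)} {C₂ : SimpleGraph (Option B)}
    (h1 : UniqueHC G C₁) (hw : ¬C₁.Adj none (some w))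
    (h2 : C₂ ≤ H) (hC2 : IsHC C₂) (hW : ∀ b ∈ W, ¬C₂.Adj none (some b))
    (hu2 : ∀ C ≤ H, IsHC C → (∀ b ∈ W, ¬C.Adj none (some b)) → C = C₂) :
    UniqueHC (glue G H (cross a₀ a₁ w b₀ b₁ W)) (glue C₁ C₂ (cross a₀ a₁ w b₀ b₁ ∅)) := by
  have hn1 := adj_two (x := some a₀) (y := some a₁) (h1.1.2.deg none) (by
    rintro (_ | a) h
    · exact absurd h C₁.irrefl
    · rcases (s.hG a).1 (h1.1.1 h) with rfl | rfl | rfl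
      · simp
      · simp
      · exact absurd h hw) (by simpa using s.a₀₁)
  refine s.uniqueHC hsplit h1.1.1 h1.1.2 hw (fun C hC hC' _ => h1.2 C hC hC') h2 hC2 hW hu2 ?_ ?_
  · intro C hC D _ hC' _ h
    rw [h1.2 C hC hC', hn1] at h
    exact absurd (.inl rfl) h
  · intro C hC D _ hC' _ h
    rw [h1.2 C hC hC', hn1] at h
    exact absurd (.inr rfl) h

section Degrees

lemma Socket.dg_inl [Finite A] [Finite B] (s : Socket G H a₀ a₁ w b₀ b₁ W)
    {a : A} (ha : a ≠ w) :
    dg (glue G H (cross a₀ a₁ w b₀ b₁ W)) (.inl a) = dg G (some a) := by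
  classical
  refine dg_glue_inl (b := if a = a₀ then b₀ else b₁) fun b' => ?_
  have := s.a₀₁
  rw [G.adj_comm, s.hG, cross]
  split_ifs <;> grind

lemma Socket.dg_inr [Finite A] [Finite B] (s : Socket G H a₀ a₁ w b₀ b₁ W) (b : B) :
    dg (glue G H (cross a₀ a₁ w b₀ b₁ W)) (.inr b) = dg H (some b) := by
  classical
  refine dg_glue_inr (a := if b = b₀ then a₀ else if b = b₁ then a₁ else w) fun a' => ?_
  have e1 := s.b₀₁
  have e2 := s.b₀W
  have e3 := s.b₁W
  rw [H.adj_comm, s.hH, cross]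
  split_ifs <;> grind

lemma Socket.dg_hub [Finite A] [Finite B] (s : Socket G H a₀ a₁ w b₀ b₁ W) :
    dg (glue G H (cross a₀ a₁ w b₀ b₁ W)) (.inl w) + 1 = dg G (some w) + W.ncard := by
  have e1 := s.a₀w
  have e2 := s.a₁w
  have hN : (glue G H (cross a₀ a₁ w b₀ b₁ W)).neighborSet (.inl w) =
      .inl '' (G.comap some).neighborSet w ∪ .inr '' W := by
    ext (a | b)
    · simp
    · simp [cross, e1.symm, e2.symm]
  have hd : Disjoint (Sum.inl '' (G.comap some).neighborSet w : Set (A ⊕ B)) (.inr '' W) := by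
    rw [Set.disjoint_left]
    rintro _ ⟨a, -, rfl⟩ ⟨b, -, h⟩
    simp at h
  rw [dg, hN, Set.ncard_union_eq hd (Set.toFinite _) (Set.toFinite _),
    Set.ncard_image_of_injective _ Sum.inl_injective,
    Set.ncard_image_of_injective _ Sum.inr_injective,
    ← (dg_comap_some G w).1 ((s.hG w).2 (.inr (.inr rfl))).symm]
  simp only [dg]
  omega

end Degrees

end UniqueGlue

/-! ### Exhaustive search for hamiltonian paths -/

section Search

/-- Depth-first search: all extensions of the reversed path `l` by `k` further vertices satisfy
`P`. -/
def allPaths (nb : ℕ → List ℕ) (P : List ℕ → Bool) : ℕ → List ℕ → Bool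
  | 0, l => P l
  | k + 1, l => (nb (l.headD 0)).all fun u => l.contains u || allPaths nb P k (u :: l)

/-- The reversed list of the first `n + 1` values of `g`. -/
def trace (g : ℕ → ℕ) : ℕ → List ℕ
  | 0 => [g 0]
  | n + 1 => g (n + 1) :: trace g n

lemma headD_trace (g : ℕ → ℕ) (n : ℕ) : (trace g n).headD 0 = g n := by
  cases n <;> rfl

lemma mem_trace {g : ℕ → ℕ} {n x : ℕ} (h : x ∈ trace g n) : ∃ i ≤ n, x = g i := by
  induction n with
  | zero => exact ⟨0, le_rfl, by simpa [trace] using h⟩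
  | succ n ih =>
    rcases List.mem_cons.1 h with h | h
    · exact ⟨n + 1, le_rfl, h⟩
    · obtain ⟨i, hi, hx⟩ := ih h
      exact ⟨i, by omega, hx⟩

/-- An injective path never takes the branch in which the search stops at a visited vertex, so the
search follows it to its end. -/
lemma allPaths_trace {nb : ℕ → List ℕ} {P : List ℕ → Bool} {g : ℕ → ℕ} {N : ℕ}
    (hinj : Set.InjOn g (Set.Iic N)) (hadj : ∀ i < N, g (i + 1) ∈ nb (g i)) (k j : ℕ)
    (hkj : j + k = N) (h : allPaths nb P k (trace g j) = true) : P (trace g N) = true := by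
  induction k generalizing j with
  | zero => rw [← hkj]; exact h
  | succ k ih =>
    rw [allPaths, List.all_eq_true, headD_trace] at h
    have h1 := h (g (j + 1)) (hadj j (by omega))
    rw [Bool.or_eq_true] at h1
    rcases h1 with h1 | h1
    · obtain ⟨i, hi, hx⟩ := mem_trace (List.contains_iff_mem.1 h1)
      have := hinj (show j + 1 ∈ Set.Iic N by simp; omega) (show i ∈ Set.Iic N by simp; omega) hx
      omega
    · exact ih (j + 1) (by omega) h1

lemma zip_tail_trace {g : ℕ → ℕ} {n a b : ℕ} (h : (a, b) ∈ (trace g n).zip (trace g n).tail) :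
    ∃ i < n, a = g (i + 1) ∧ b = g i := by
  induction n with
  | zero => simp [trace] at h
  | succ n ih =>
    have h' : (a, b) ∈ (g (n + 1) :: trace g n).zip (trace g n) := h
    have h2 : trace g n = g n :: (trace g n).tail := by cases n <;> rfl
    rw [h2, List.zip_cons_cons, List.mem_cons, ← h2] at h'
    rcases h' with h' | h'
    · rw [Prod.mk.injEq] at h'
      exact ⟨n, by omega, h'.1, h'.2⟩
    · obtain ⟨i, hi, h3⟩ := ih h'
      exact ⟨i, by omega, h3⟩

variable {V : Type} [Fintype V]

lemma IsHC.exists_enum {C : SimpleGraph V} (hC : IsHC C) {s t : V} (hst : C.Adj s t) {n : ℕ}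
    (hn : Fintype.card V = n + 1) : ∃ f : ℕ → V, f 0 = s ∧ f 1 = t ∧ f (n + 1) = s ∧
      Set.InjOn f (Set.Iic n) ∧ (∀ i ≤ n, C.Adj (f i) (f (i + 1))) ∧ ∀ v, ∃ i ≤ n, f i = v := by
  classical
  obtain ⟨p, hp, hs, -⟩ := hC.exists_walk hst
  have hlen : p.length = n + 1 := hp.length_eq.trans hn
  refine ⟨p.getVert, p.getVert_zero, hs, ?_, ?_, fun i hi => p.adj_getVert_succ (by omega), ?_⟩
  · rw [← hlen]; exact p.getVert_length
  · exact hp.isCycle.getVert_injOn'.mono fun i hi => by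
      simp only [Set.mem_Iic, Set.mem_ofPred_eq] at hi ⊢; omega
  · intro v
    obtain ⟨i, hi, hle⟩ := SimpleGraph.Walk.mem_support_iff_exists_getVert.1 (hp.mem_support v)
    by_cases h : i = n + 1
    · refine ⟨0, by omega, ?_⟩
      rw [← hi, h, ← hlen, p.getVert_length, p.getVert_zero]
    · exact ⟨i, by omega, hi⟩

/-- If the search from `[t, s]` finds at most the path `L` among the hamiltonian paths ending in
`r`, then all hamiltonian cycles in which `s` has the neighbours `t` and `r` follow `L`. -/
theorem IsHC.eq_of_allPaths {C : SimpleGraph V} (hC : IsHC C) {s t r : V} (hst : C.Adj s t)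
    (hs : ∀ u, C.Adj s u → u = t ∨ u = r) {enc : V → ℕ} (henc : enc.Injective)
    {nb : ℕ → List ℕ} (hnb : ∀ u v, C.Adj u v → enc v ∈ nb (enc u)) {n : ℕ}
    (hn : Fintype.card V = n + 3) {L : List ℕ}
    (hL : allPaths nb (fun l => l.headD 0 != enc r || l == L) (n + 1) [enc t, enc s] = true) :
    C.Adj s r ∧ enc r = L.headD 0 ∧
      ∀ u v, (enc u, enc v) ∈ L.zip L.tail → C.Adj u v := by
  obtain ⟨f, h0, h1, hlast, hinj, hadj, -⟩ := hC.exists_enum hst (n := n + 2) hn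
  have hr : f (n + 2) = r := by
    have h2 := hadj (n + 2) le_rfl
    rw [hlast] at h2
    rcases hs _ h2.symm with h | h
    · rw [← h1] at h
      have := hinj (show n + 2 ∈ Set.Iic (n + 2) by simp) (show 1 ∈ Set.Iic (n + 2) by simp) h
      omega
    · exact h
  have hg : Set.InjOn (fun i => enc (f i)) (Set.Iic (n + 2)) := fun i hi j hj h =>
    hinj hi hj (henc h)
  -- The list `[enc t, enc s]` is the trace up to index 1, and `n + 1` further vertices complete the
  -- `n + 3`.
  have key := allPaths_trace (g := fun i => enc (f i))
    (P := fun l => l.headD 0 != enc r || l == L) hg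
    (fun i hi => hnb _ _ (hadj i hi.le)) (n + 1) 1 (by omega) (by
      change allPaths _ _ _ [enc (f 1), enc (f 0)] = true
      rw [h0, h1]; exact hL)
  beta_reduce at key
  rw [headD_trace, hr, bne_self_eq_false, Bool.false_or, beq_iff_eq] at key
  refine ⟨?_, ?_, fun u v huv => ?_⟩
  · have h2 := hadj (n + 2) le_rfl
    rw [hlast, hr] at h2
    exact h2.symm
  · rw [← key, headD_trace, hr]
  · rw [← key] at huv
    obtain ⟨i, hi, hu, hv⟩ := zip_tail_trace huv
    rw [henc hu, henc hv]
    exact (hadj i hi.le).symm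

end Search

/-! ### Concrete graphs and cycles given by lists of numbers -/

section Coded

/-- Code numbers for the elements of `Option (Fin k)`. -/
def code {k : ℕ} : Option (Fin k) → ℕ
  | none => 0
  | some i => i + 1

lemma code_injective {k : ℕ} : Function.Injective (code (k := k)) := by
  rintro (_ | x) (_ | y) h
  · rfl
  · simp [code] at h
  · simp [code] at h
  · simp only [code, Nat.add_right_cancel_iff] at h
    rw [Fin.ext h]

/-- The graph on `Option (Fin k)` with neighbourhoods listed by `nb`. -/
def ofNb (k : ℕ) (nb : ℕ → List ℕ) : SimpleGraph (Option (Fin k)) where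
  Adj u v := u ≠ v ∧ (code v ∈ nb (code u) ∨ code u ∈ nb (code v))
  symm.symm _ _ h := ⟨h.1.symm, h.2.symm⟩
  loopless.irrefl _ h := h.1 rfl

instance (k : ℕ) (nb : ℕ → List ℕ) : DecidableRel (ofNb k nb).Adj := fun u v =>
  inferInstanceAs (Decidable (u ≠ v ∧ (code v ∈ nb (code u) ∨ code u ∈ nb (code v))))

/-- The cycle on `Option (Fin k)` described by a list of codes. -/
def ofList (k : ℕ) (L : List ℕ) : SimpleGraph (Option (Fin k)) where
  Adj u v := u ≠ v ∧ ((code u, code v) ∈ (L.getLastD 0, L.headD 0) :: L.zip L.tail ∨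
    (code v, code u) ∈ (L.getLastD 0, L.headD 0) :: L.zip L.tail)
  symm.symm _ _ h := ⟨h.1.symm, h.2.symm⟩
  loopless.irrefl _ h := h.1 rfl

instance (k : ℕ) (L : List ℕ) : DecidableRel (ofList k L).Adj := fun u v =>
  inferInstanceAs (Decidable (u ≠ v ∧ (_ ∨ _)))

lemma eq_of_le_of_isHC {V : Type} [Finite V] {C D : SimpleGraph V} (h : C ≤ D)
    (hC : ∀ v, dg C v = 2) (hD : ∀ v, dg D v = 2) : D = C := by
  ext u v
  rw [← SimpleGraph.mem_neighborSet, ← SimpleGraph.mem_neighborSet,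
    Set.eq_of_subset_of_ncard_le (s := C.neighborSet u) (t := D.neighborSet u)
      (fun x hx => h hx) (by have := hC u; have := hD u; simp only [dg] at *; omega)
      (Set.toFinite _)]

lemma connected_of_rank {V : Type} {C : SimpleGraph V} (s : V) (rank : V → ℕ)
    (h : ∀ v, v ≠ s → ∃ u, C.Adj v u ∧ rank u < rank v) : C.Connected := by
  have key : ∀ n v, rank v = n → C.Reachable v s := by
    intro n
    induction n using Nat.strong_induction_on with
    | _ n ih =>
      intro v hv
      by_cases hs : v = s
      · rw [hs]
      · obtain ⟨u, hu, hr⟩ := h v hs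
        exact (SimpleGraph.Adj.reachable hu).trans (ih _ (hv ▸ hr) u rfl)
  have : Nonempty V := ⟨s⟩
  exact ⟨fun u v => (key _ u rfl).trans (key _ v rfl).symm⟩

lemma dg_eq_card {V : Type} [Fintype V] (G : SimpleGraph V) [DecidableRel G.Adj] (v : V) :
    dg G v = (Finset.univ.filter fun u => G.Adj v u).card := by
  rw [dg, ← Set.ncard_coe_finset]
  congr 1
  ext u
  simp

/-- Connectivity is certified by positions in `L`: each vertex other than `none` has a neighbour
further on, so moving forward ends at `none`. -/
lemma isHC_ofList {k : ℕ} {L : List ℕ}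
    (hdeg : ∀ v, (Finset.univ.filter fun u => (ofList k L).Adj v u).card = 2)
    (hrank : ∀ v, v ≠ none → ∃ u, (ofList k L).Adj v u ∧ L.idxOf (code v) < L.idxOf (code u)) :
    IsHC (ofList k L) := by
  refine ⟨connected_of_rank none (fun v => L.length - L.idxOf (code v)) fun v hv => ?_, fun v => ?_⟩
  · obtain ⟨u, hu, h⟩ := hrank v hv
    have := List.idxOf_le_length (a := code u) (l := L)
    exact ⟨u, hu, by omega⟩
  · rw [dg_eq_card, hdeg]

/-- The hamiltonian cycles of a graph on `Option (Fin k)` in which `none` has prescribed neighbours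
`t` and `r`: there is only one if the search finds only one. -/
theorem eq_ofList_of_allPaths {n : ℕ} {H : SimpleGraph (Option (Fin (n + 2)))} {nb : ℕ → List ℕ}
    (hnb : ∀ u v, H.Adj u v → code v ∈ nb (code u)) {L : List ℕ} (hC₂ : IsHC (ofList (n + 2) L))
    {t r : Fin (n + 2)} (hlast : L.getLastD 0 = 0)
    (hL : allPaths nb (fun l => l.headD 0 != code (some r) || l == L) (n + 1) [code (some t), 0] =
      true) {C : SimpleGraph (Option (Fin (n + 2)))} (hle : C ≤ H) (hC : IsHC C)
    (ht : C.Adj none (some t)) (hs : ∀ u, C.Adj none u → u = some t ∨ u = some r) :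
    C = ofList (n + 2) L := by
  obtain ⟨h1, h2, h3⟩ := hC.eq_of_allPaths (s := none) ht hs code_injective
    (fun u v h => hnb u v (hle h)) (n := n) (by simp) hL
  refine eq_of_le_of_isHC ?_ hC₂.deg hC.deg
  have key : ∀ u v, (code u, code v) ∈ (L.getLastD 0, L.headD 0) :: L.zip L.tail → C.Adj u v := by
    intro u v h
    rcases List.mem_cons.1 h with h | h
    · rw [Prod.mk.injEq, hlast, ← h2] at h
      rw [code_injective (a₁ := u) (a₂ := none) h.1, code_injective h.2]
      exact h1
    · exact h3 u v h
  rintro u v ⟨-, h | h⟩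
  · exact key u v h
  · exact (key v u h).symm

end Coded

/-! ### Checking connectivity of concrete graphs -/

section ConnCheck

/-- One vertex after the other, add the neighbours of the visited vertices that are not `x` or
`y`. -/
def explore (nb : ℕ → List ℕ) (x y : ℕ) : ℕ → List ℕ → List ℕ
  | 0, l => l
  | k + 1, l => explore nb x y k <| l.foldr (fun v acc => (nb v).foldr
      (fun u acc => if acc.contains u || u == x || u == y then acc else u :: acc) acc) l

/-- Every vertex other than `x` and `y` is found from every other one. -/
def connCheck (nb : ℕ → List ℕ) (k : ℕ) : Bool :=
  (List.range (k + 1)).all fun x => (List.range (k + 1)).all fun y =>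
    match (List.range (k + 1)).filter fun z => z != x && z != y with
    | [] => true
    | s :: l => let r := explore nb x y k [s]
      l.all fun z => r.contains z

lemma foldr_invariant {α β : Type*} (Q : β → Prop) (f : α → β → β) (l : List α) (b : β) (hb : Q b)
    (hf : ∀ a ∈ l, ∀ b, Q b → Q (f a b)) : Q (l.foldr f b) := by
  induction l with
  | nil => exact hb
  | cons a l ih =>
    exact hf a (by simp) _ (ih fun a' ha' => hf a' (by simp [ha']))

variable {k : ℕ} {nb : ℕ → List ℕ}

lemma code_surj {c : ℕ} (hc : c < k + 1) : ∃ v : Option (Fin k), code v = c := by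
  rcases c with _ | c
  · exact ⟨none, rfl⟩
  · exact ⟨some ⟨c, by omega⟩, rfl⟩

lemma code_lt (v : Option (Fin k)) : code v < k + 1 := by
  rcases v with _ | v
  · simp [code]
  · have := v.2
    simp only [code]; omega

lemma explore_reachable (hnb : ∀ c < k + 1, ∀ d ∈ nb c, d < k + 1 ∧ d ≠ c) (x y s : Option (Fin k))
    (n : ℕ) (l : List ℕ)
    (hl : ∀ c ∈ l, ∃ v, code v = c ∧ v ∉ ({x, y} : Set _) ∧
      (del (ofNb k nb) {x, y}).Reachable s v) :
    ∀ c ∈ explore nb (code x) (code y) n l, ∃ v, code v = c ∧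
      (del (ofNb k nb) {x, y}).Reachable s v := by
  induction n generalizing l with
  | zero => intro c hc; obtain ⟨v, h1, -, h2⟩ := hl c hc; exact ⟨v, h1, h2⟩
  | succ n ih =>
    refine ih _ (foldr_invariant (fun m : List ℕ => ∀ c ∈ m, ∃ v, code v = c ∧
      v ∉ ({x, y} : Set _) ∧ (del (ofNb k nb) {x, y}).Reachable s v) _ l l hl ?_)
    intro c hc m hm
    obtain ⟨v, rfl, hv, hr⟩ := hl c hc
    refine foldr_invariant (fun m : List ℕ => ∀ c ∈ m, ∃ v, code v = c ∧
      v ∉ ({x, y} : Set _) ∧ (del (ofNb k nb) {x, y}).Reachable s v) _ _ m hm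
      fun d hd m' hm' => ?_
    split_ifs with hcond
    · exact hm'
    · intro e he
      rcases List.mem_cons.1 he with rfl | he
      · obtain ⟨hlt, hne⟩ := hnb _ (code_lt v) _ hd
        obtain ⟨u, rfl⟩ := code_surj hlt
        simp only [Bool.or_eq_true, beq_iff_eq, not_or] at hcond
        have hu : u ∉ ({x, y} : Set _) := by
          simp only [Set.mem_insert_iff, Set.mem_singleton_iff, not_or]
          exact ⟨fun h => hcond.1.2 (h ▸ rfl), fun h => hcond.2 (h ▸ rfl)⟩
        refine ⟨u, rfl, hu, hr.trans (SimpleGraph.Adj.reachable ?_)⟩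
        exact ⟨⟨fun h => hne (h ▸ rfl), .inl hd⟩, hv, hu⟩
      · exact hm' e he

theorem connOff_ofNb (hnb : ∀ c < k + 1, ∀ d ∈ nb c, d < k + 1 ∧ d ≠ c)
    (h : connCheck nb k = true) (x y : Option (Fin k)) : ConnOff (ofNb k nb) {x, y} := by
  rw [connCheck, List.all_eq_true] at h
  have h := h (code x) (List.mem_range.2 (code_lt x))
  rw [List.all_eq_true] at h
  have h := h (code y) (List.mem_range.2 (code_lt y))
  have hmem : ∀ v : Option (Fin k), v ∉ ({x, y} : Set _) →
      code v ∈ (List.range (k + 1)).filter fun z => z != code x && z != code y := by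
    intro v hv
    simp only [Set.mem_insert_iff, Set.mem_singleton_iff, not_or] at hv
    simp only [List.mem_filter, List.mem_range, code_lt, true_and, Bool.and_eq_true, bne_iff_ne]
    exact ⟨fun h => hv.1 (code_injective h), fun h => hv.2 (code_injective h)⟩
  rcases hl : (List.range (k + 1)).filter fun z => z != code x && z != code y with _ | ⟨s, l⟩
  · intro u v hu
    have := hmem u hu
    rw [hl] at this
    simp at this
  · rw [hl] at h
    simp only [List.all_eq_true] at h
    have hs : s ∈ (List.range (k + 1)).filter fun z => z != code x && z != code y := by
      rw [hl]; simp
    simp only [List.mem_filter, List.mem_range, Bool.and_eq_true, bne_iff_ne] at hs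
    obtain ⟨s', rfl⟩ := code_surj hs.1
    have hs' : s' ∉ ({x, y} : Set _) := by
      simp only [Set.mem_insert_iff, Set.mem_singleton_iff, not_or]
      exact ⟨fun h => hs.2.1 (h ▸ rfl), fun h => hs.2.2 (h ▸ rfl)⟩
    have key : ∀ v, v ∉ ({x, y} : Set _) → (del (ofNb k nb) {x, y}).Reachable s' v := by
      intro v hv
      have hv := hmem v hv
      rw [hl] at hv
      rcases List.mem_cons.1 hv with hv | hv
      · rw [code_injective hv]
      · obtain ⟨u, hu, hr⟩ := explore_reachable hnb x y s' k [code s']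
          (by simpa using ⟨s', rfl, by simpa using hs', .rfl⟩) _ (List.contains_iff_mem.1 (h _ hv))
        rw [← code_injective hu]; exact hr
    exact fun u v hu hv => (key u hu).symm.trans (key v hv)

end ConnCheck

/-! ### The gadgets: triangle, wheel, Petersen piece and base graph -/

/-- `H` can replace a vertex with two cycle edges and one other edge: exactly one hamiltonian cycle
of `H` avoids the edges between `none` and `W`, and `H` does not contain a spanning pair of paths
from `b₀` and `b₁` to `W`. -/
structure Gadget {k : ℕ} (H C : SimpleGraph (Option (Fin k))) (b₀ b₁ : Fin k) (W : Set (Fin k)) :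
    Prop where
  b₀₁ : b₀ ≠ b₁
  b₀W : b₀ ∉ W
  b₁W : b₁ ∉ W
  hH : ∀ b, H.Adj none (some b) ↔ b = b₀ ∨ b = b₁ ∨ b ∈ W
  conn : ∀ x y, ConnOff H {x, y}
  split : ∀ D ≤ splitNone H b₀ b₁ W, ¬IsHC D
  le : C ≤ H
  isHC : IsHC C
  avoid : ∀ b ∈ W, ¬C.Adj none (some b)
  uniq : ∀ D ≤ H, IsHC D → (∀ b ∈ W, ¬D.Adj none (some b)) → D = C

lemma adj_none_of_avoid {k : ℕ} {H : SimpleGraph (Option (Fin k))} {b₀ b₁ : Fin k}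
    {W : Set (Fin k)} (h01 : b₀ ≠ b₁) (hH : ∀ b, H.Adj none (some b) ↔ b = b₀ ∨ b = b₁ ∨ b ∈ W)
    {D : SimpleGraph (Option (Fin k))} (hD : D ≤ H) (hC : IsHC D)
    (hW : ∀ b ∈ W, ¬D.Adj none (some b)) : ∀ u, D.Adj none u ↔ u = some b₀ ∨ u = some b₁ := by
  refine adj_two (hC.deg none) ?_ (by simpa using h01)
  rintro (_ | b) h
  · exact absurd h D.irrefl
  · rcases (hH b).1 (hD h) with rfl | rfl | hb
    · simp
    · simp
    · exact absurd h (hW b hb)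

theorem gadget_ofNb {n : ℕ} {nb : ℕ → List ℕ} {L : List ℕ} {b₀ b₁ : Fin (n + 2)}
    {W : Set (Fin (n + 2))} (h01 : b₀ ≠ b₁) (h0W : b₀ ∉ W) (h1W : b₁ ∉ W)
    (hH : ∀ b, (ofNb (n + 2) nb).Adj none (some b) ↔ b = b₀ ∨ b = b₁ ∨ b ∈ W)
    (hnb : ∀ c < n + 3, ∀ d ∈ nb c, d < n + 3 ∧ d ≠ c) (hcon : connCheck nb (n + 2) = true)
    (hsymm : ∀ u v, (ofNb (n + 2) nb).Adj u v → code v ∈ nb (code u))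
    (hsplit : ∀ D ≤ splitNone (ofNb (n + 2) nb) b₀ b₁ W, ¬IsHC D)
    (hle : ∀ u v, (ofList (n + 2) L).Adj u v → (ofNb (n + 2) nb).Adj u v)
    (hdeg : ∀ v, (Finset.univ.filter fun u => (ofList (n + 2) L).Adj v u).card = 2)
    (hrank : ∀ v, v ≠ none →
      ∃ u, (ofList (n + 2) L).Adj v u ∧ L.idxOf (code v) < L.idxOf (code u))
    (havoid : ∀ b ∈ W, ¬(ofList (n + 2) L).Adj none (some b)) (hlast : L.getLastD 0 = 0)
    (hL : allPaths nb (fun l => l.headD 0 != code (some b₁) || l == L) (n + 1)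
      [code (some b₀), 0] = true) :
    Gadget (ofNb (n + 2) nb) (ofList (n + 2) L) b₀ b₁ W where
  b₀₁ := h01
  b₀W := h0W
  b₁W := h1W
  hH := hH
  conn := connOff_ofNb hnb hcon
  split := hsplit
  le := fun u v => hle u v
  isHC := isHC_ofList hdeg hrank
  avoid := havoid
  uniq := fun D hD hC hW => by
    have h := adj_none_of_avoid h01 hH hD hC hW
    exact eq_ofList_of_allPaths hsymm (isHC_ofList hdeg hrank) hlast hL hD hC
      ((h _).2 (.inl rfl)) fun u hu => (h u).1 hu

/-- The complete graph on four vertices. -/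
def nbTriangle (n : ℕ) : List ℕ := [[1, 2, 3], [0, 2, 3], [0, 1, 3], [0, 1, 2]].getD n []

theorem gadget_triangle : Gadget (ofNb 3 nbTriangle) (ofList 3 [2, 3, 1, 0]) 0 1 {2} := by
  apply gadget_ofNb (n := 1)
  · decide
  · decide
  · decide
  · simp only [Set.mem_singleton_iff]; decide +kernel
  · decide +kernel
  · decide +kernel
  · decide +kernel
  · exact not_isHC_splitNone_singleton _ _ _ _
  · decide +kernel
  · decide +kernel
  · decide +kernel
  · simp only [Set.mem_singleton_iff]; decide +kernel
  · decide +kernel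
  · decide +kernel

/-- The wheel with four spokes, the hub having number `1`. -/
def nbWheel (n : ℕ) : List ℕ :=
  [[1, 2, 4], [0, 2, 3, 4], [0, 1, 3], [1, 2, 4], [0, 1, 3]].getD n []

theorem gadget_wheel : Gadget (ofNb 4 nbWheel) (ofList 4 [2, 3, 4, 1, 0]) 0 1 {3} := by
  apply gadget_ofNb (n := 2)
  · decide
  · decide
  · decide
  · simp only [Set.mem_singleton_iff]; decide +kernel
  · decide +kernel
  · decide +kernel
  · decide +kernel
  · exact not_isHC_splitNone_singleton _ _ _ _
  · decide +kernel
  · decide +kernel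
  · decide +kernel
  · simp only [Set.mem_singleton_iff]; decide +kernel
  · decide +kernel
  · decide +kernel

/-- The Petersen graph with an edge subdivided by a vertex that is then identified with another
vertex. -/
def nbPetersen (n : ℕ) : List ℕ :=
  [[1, 2, 3, 4, 5], [8, 4, 0], [6, 5, 0], [8, 6, 0], [7, 1, 0], [2, 9, 0], [2, 7, 3], [6, 4, 9],
    [1, 3, 9], [5, 7, 8]].getD n []

/-- The Petersen graph with an edge subdivided. -/
def nbPetersenSplit (n : ℕ) : List ℕ :=
  [[1, 2], [8, 4, 0], [6, 5, 0], [8, 6, 10], [7, 1, 10], [2, 9, 10], [2, 7, 3], [6, 4, 9],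
    [1, 3, 9], [5, 7, 8], [3, 4, 5]].getD n []

/-- Code numbers for the vertices of a split graph. -/
def codeSplit : Option (Option (Fin 9)) → ℕ
  | none => 0
  | some none => 10
  | some (some i) => i + 1

/-- The split graph is the Petersen graph with a subdivided edge. A hamiltonian cycle of it would
pass through the subdividing vertex and yield one of the Petersen graph, which has none. -/
lemma not_isHC_splitNone_petersen :
    ∀ D ≤ splitNone (ofNb 9 nbPetersen) 0 1 {2, 3, 4}, ¬IsHC D := by
  intro D hD hC
  have h := adj_two (x := some (some 0)) (y := some (some 1)) (hC.deg none) (by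
    rintro (_ | _ | b) hb
    · exact (hD hb).elim
    · exact (hD hb).elim
    · rcases (hD hb : b = 0 ∨ b = 1) with rfl | rfl <;> simp) (by decide)
  have hb : ∀ b b' : Fin 9, (ofNb 9 nbPetersen).Adj (some b) (some b') →
      codeSplit (some (some b')) ∈ nbPetersenSplit (codeSplit (some (some b))) := by
    decide +kernel
  have hx : ∀ b : Fin 9, b = 0 ∨ b = 1 →
      codeSplit (some (some b)) ∈ nbPetersenSplit 0 ∧
        0 ∈ nbPetersenSplit (codeSplit (some (some b))) := by
    decide +kernel
  have hw : ∀ b : Fin 9, b = 2 ∨ b = 3 ∨ b = 4 →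
      codeSplit (some (some b)) ∈ nbPetersenSplit 10 ∧
        10 ∈ nbPetersenSplit (codeSplit (some (some b))) := by
    decide +kernel
  -- No path equals `L = []`, so a successful search means that no hamiltonian path ends in `r`. The
  -- contradiction is then that the code of `r` would equal the default head 0 of `[]`.
  have key := hC.eq_of_allPaths (s := none) (t := some (some 0)) (r := some (some 1))
    ((h _).2 (.inl rfl)) (fun u hu => (h u).1 hu) (enc := codeSplit) (by decide +kernel)
    (nb := nbPetersenSplit) (by
      intro u v huv
      have := hD huv
      rcases u with _ | _ | u <;> rcases v with _ | _ | v
      exacts [this.elim, this.elim, (hx v this).1, this.elim, this.elim, (hw v this).1,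
        (hx u this).2, (hw u this).2, hb u v this])
    (n := 8) (by simp) (L := []) (by decide +kernel)
  exact absurd key.2.1 (by decide)

theorem gadget_petersen :
    Gadget (ofNb 9 nbPetersen) (ofList 9 [2, 5, 9, 8, 3, 6, 7, 4, 1, 0]) 0 1 {2, 3, 4} := by
  apply gadget_ofNb (n := 7)
  · decide
  · simp
  · simp
  · simp only [Set.mem_singleton_iff, Set.mem_insert_iff]; decide +kernel
  · decide +kernel
  · decide +kernel
  · decide +kernel
  · exact not_isHC_splitNone_petersen
  · decide +kernel
  · decide +kernel
  · decide +kernel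
  · simp only [Set.mem_singleton_iff, Set.mem_insert_iff]; decide +kernel
  · decide +kernel
  · decide +kernel

/-- A graph with a vertex of degree four (number `1`), all of whose hamiltonian cycles use the edge
from `none` to that vertex. -/
def nbBase (n : ℕ) : List ℕ :=
  [[1, 2, 3], [12, 10, 11, 0], [6, 11, 0], [5, 6, 0], [12, 5, 9], [4, 3, 10], [3, 7, 2], [6, 8, 12],
    [7, 9, 10], [4, 8, 11], [1, 5, 8], [1, 9, 2], [1, 4, 7]].getD n []

lemma base_symm : ∀ u v, (ofNb 12 nbBase).Adj u v → code v ∈ nbBase (code u) := by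
  decide +kernel

lemma base_none : ∀ b : Fin 12, (ofNb 12 nbBase).Adj none (some b) ↔ b = 0 ∨ b = 1 ∨ b = 2 := by
  decide +kernel

set_option maxHeartbeats 2000000 in
theorem gadget_base :
    Gadget (ofNb 12 nbBase) (ofList 12 [1, 11, 9, 4, 12, 7, 8, 10, 5, 3, 6, 2, 0]) 1 0 {2} := by
  apply gadget_ofNb (n := 10)
  · decide
  · decide
  · decide
  · simp only [Set.mem_singleton_iff]; decide +kernel
  · decide +kernel
  · decide +kernel
  · exact base_symm
  · exact not_isHC_splitNone_singleton _ _ _ _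
  · decide +kernel
  · decide +kernel
  · decide +kernel
  · simp only [Set.mem_singleton_iff]; decide +kernel
  · decide +kernel
  · decide +kernel

/-- A cycle without this edge would pass through `none` between its two other neighbours; the search
with `L = []` excludes this. -/
lemma base_hub {C : SimpleGraph (Option (Fin 12))} (hle : C ≤ ofNb 12 nbBase) (hC : IsHC C) :
    C.Adj none (some 0) := by
  by_contra hcon
  have h := adj_none_of_avoid (b₀ := 1) (b₁ := 2) (W := {0}) (by decide)
    (fun b => (base_none b).trans (by rw [Set.mem_singleton_iff]; tauto)) hle hC
    (by simpa using hcon)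
  have key := hC.eq_of_allPaths (s := none) (t := some 1) (r := some 2)
    ((h _).2 (.inl rfl)) (fun u hu => (h u).1 hu) code_injective
    (fun u v huv => base_symm u v (hle huv)) (n := 10) (by simp) (L := []) (by decide +kernel)
  exact absurd key.2.1 (by decide)

/-! ### Relabelling vertices and counting -/

section Transport

variable {V V' : Type}

lemma isHC_comap_equiv (e : V' ≃ V) {C : SimpleGraph V} (hC : IsHC C) : IsHC (C.comap e) :=
  ⟨(SimpleGraph.Iso.comap e C).connected_iff.2 hC.conn, fun v => by
    rw [dg_comap_equiv, hC.deg]⟩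

lemma comap_symm_comap (e : V' ≃ V) (C : SimpleGraph V') : (C.comap e.symm).comap e = C := by
  ext u v; simp

lemma uniqueHC_comap_equiv [Finite V] [Finite V'] (e : V' ≃ V) {G C : SimpleGraph V}
    (h : UniqueHC G C) : UniqueHC (G.comap e) (C.comap e) := by
  refine ⟨⟨fun u v huv => h.1.1 huv, isHC_comap_equiv e h.1.2⟩, fun C' hle hC' => ?_⟩
  rw [← h.2 (C'.comap e.symm) (fun u v huv => by simpa using hle huv)
    (isHC_comap_equiv e.symm hC'), comap_symm_comap]

end Transport

section Counting

lemma ncard_sum {A B : Type} [Finite A] [Finite B] (P : A ⊕ B → Prop) :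
    {u | P u}.ncard = {a | P (.inl a)}.ncard + {b | P (.inr b)}.ncard := by
  have h : {u | P u} = Sum.inl '' {a | P (.inl a)} ∪ Sum.inr '' {b | P (.inr b)} := by
    ext (a | b) <;> simp
  have hd : Disjoint (Sum.inl '' {a | P (.inl a)}) (Sum.inr '' {b | P (.inr b)}) := by
    rw [Set.disjoint_left]
    rintro _ ⟨a, -, rfl⟩ ⟨b, -, h⟩
    simp at h
  rw [h, Set.ncard_union_eq hd (Set.toFinite _) (Set.toFinite _),
    Set.ncard_image_of_injective _ Sum.inl_injective,
    Set.ncard_image_of_injective _ Sum.inr_injective]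

open Classical in
lemma ncard_option {A : Type} [Finite A] (P : Option A → Prop) :
    {u | P u}.ncard = {a | P (some a)}.ncard + if P none then 1 else 0 := by
  have h : {u | P u} = some '' {a | P (some a)} ∪ {u | u = none ∧ P none} := by
    ext (_ | a) <;> simp
  have hd : Disjoint (some '' {a | P (some a)}) {u | u = none ∧ P none} := by
    rw [Set.disjoint_left]
    rintro _ ⟨a, -, rfl⟩ ⟨h, -⟩
    simp at h
  rw [h, Set.ncard_union_eq hd (Set.toFinite _) (Set.toFinite _),
    Set.ncard_image_of_injective _ (Option.some_injective A)]
  split_ifs with hP <;> simp [hP]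

end Counting

/-! ### Building uniquely hamiltonian graphs with controlled degrees -/

/-- `G` has the unique hamiltonian cycle `C` and remains connected if two vertices are deleted. The
distinct vertices `w i` of degree `d i` have distinct neighbours `v i` of degree three to which they
are not joined by edges of `C`, and `f k` other vertices have degree `k`. -/
structure IsGood {ι V : Type} [Finite V] (G C : SimpleGraph V) (w v : ι → V) (d : ι → ℕ) (n : ℕ)
    (f : ℕ → ℕ) : Prop where
  conn : ∀ x y, ConnOff G {x, y}
  uniq : UniqueHC G C
  w_inj : w.Injective
  v_inj : v.Injective
  w_ne_v : ∀ i j, w i ≠ v j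
  adj : ∀ i, G.Adj (w i) (v i)
  not_adj : ∀ i, ¬C.Adj (w i) (v i)
  dg_w : ∀ i, dg G (w i) = d i
  dg_v : ∀ i, dg G (v i) = 3
  count : ∀ k, {u | u ∉ Set.range w ∧ dg G u = k}.ncard = f k
  card : Nat.card V = n

/-- Some graph is good with the given parameters. -/
def Good (ι : Type) (n : ℕ) (f : ℕ → ℕ) (d : ι → ℕ) : Prop :=
  ∃ (V : Type) (_ : Finite V) (G C : SimpleGraph V) (w v : ι → V), IsGood G C w v d n f

section Good

variable {ι : Type} {d : ι → ℕ} {n : ℕ} {f : ℕ → ℕ}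

lemma IsGood.comap {V V' : Type} [Finite V] [Finite V'] {G C : SimpleGraph V} {w v : ι → V}
    (h : IsGood G C w v d n f) (e : V' ≃ V) :
    IsGood (G.comap e) (C.comap e) (e.symm ∘ w) (e.symm ∘ v) d n f where
  conn x y := by
    have := (connOff_comap_equiv e G {e x, e y}).2 (h.conn _ _)
    convert this using 1
    ext z; simp
  uniq := uniqueHC_comap_equiv e h.uniq
  w_inj := e.symm.injective.comp h.w_inj
  v_inj := e.symm.injective.comp h.v_inj
  w_ne_v i j hij := h.w_ne_v i j (e.symm.injective hij)
  adj i := by simpa using h.adj i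
  not_adj i := by simpa using h.not_adj i
  dg_w i := by simpa [dg_comap_equiv] using h.dg_w i
  dg_v i := by simpa [dg_comap_equiv] using h.dg_v i
  count k := by
    rw [← h.count k, ← Set.ncard_image_of_injective _ e.injective]
    congr 1
    ext x
    simp only [Set.mem_image, Set.mem_ofPred_eq, Set.mem_range, Function.comp_apply,
      dg_comap_equiv]
    constructor
    · rintro ⟨y, ⟨h1, h2⟩, rfl⟩
      exact ⟨fun ⟨i, hi⟩ => h1 ⟨i, by simp [hi]⟩, h2⟩
    · rintro ⟨h1, h2⟩
      exact ⟨e.symm x, ⟨fun ⟨i, hi⟩ => h1 ⟨i, e.symm.injective hi⟩, by simpa using h2⟩, by simp⟩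
  card := by rw [Nat.card_congr e, h.card]

/-- A chosen vertex of a good graph may be assumed to be `none`. -/
lemma IsGood.exists_option {V : Type} [Finite V] {G C : SimpleGraph V} {w v : ι → V}
    (h : IsGood G C w v d n f) (z : V) :
    ∃ (A : Type) (_ : Finite A) (e : Option A ≃ V), e none = z ∧
      IsGood (G.comap e) (C.comap e) (e.symm ∘ w) (e.symm ∘ v) d n f := by
  classical
  exact ⟨{u // u ≠ z}, inferInstance, Equiv.optionSubtypeNe z, by simp, h.comap _⟩

lemma exists_cubic_nbrs {A : Type} [Finite A] {G C : SimpleGraph (Option A)} (hle : C ≤ G)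
    (hC : IsHC C) (hd : dg G none = 3) : ∃ a₀ a₁ w, a₀ ≠ a₁ ∧ a₀ ≠ w ∧ a₁ ≠ w ∧
      (∀ a, G.Adj none (some a) ↔ a = a₀ ∨ a = a₁ ∨ a = w) ∧
      ∀ a, C.Adj none (some a) ↔ a = a₀ ∨ a = a₁ := by
  obtain ⟨p, q, hpq, hN⟩ := Set.ncard_eq_two.1 (hC.deg none)
  have hadj : ∀ x, C.Adj none x ↔ x = p ∨ x = q := fun x => by
    rw [← SimpleGraph.mem_neighborSet, hN]; simp
  obtain ⟨p, rfl⟩ : ∃ a, p = some a := Option.ne_none_iff_exists'.1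
    fun h => C.irrefl (h ▸ (hadj p).2 (.inl rfl))
  obtain ⟨q, rfl⟩ : ∃ a, q = some a := Option.ne_none_iff_exists'.1
    fun h => C.irrefl (h ▸ (hadj q).2 (.inr rfl))
  have hsub : C.neighborSet none ⊆ G.neighborSet none := fun x hx => hle hx
  have hcard : (G.neighborSet none \ C.neighborSet none).ncard = 1 := by
    have h1 := Set.ncard_sdiff_add_ncard_of_subset hsub
    have h2 := hC.deg none
    simp only [dg] at h2 hd
    omega
  obtain ⟨r, hr⟩ := Set.ncard_eq_one.1 hcard
  have hG : ∀ x, G.Adj none x ↔ x = some p ∨ x = some q ∨ x = r := by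
    intro x
    have h1 : x ∈ G.neighborSet none ↔
        x ∈ C.neighborSet none ∨ x ∈ G.neighborSet none \ C.neighborSet none := by
      rw [Set.mem_sdiff]
      constructor
      · intro h; tauto
      · rintro (h | h)
        exacts [hsub h, h.1]
    rw [hr, hN] at h1
    simpa [or_assoc] using h1
  have hrC : ¬C.Adj none r := by
    have : r ∈ G.neighborSet none \ C.neighborSet none := by rw [hr]; rfl
    exact this.2
  obtain ⟨r, rfl⟩ : ∃ a, r = some a := Option.ne_none_iff_exists'.1
    fun h => G.irrefl (h ▸ (hG r).2 (.inr (.inr rfl)))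
  refine ⟨p, q, r, fun h => hpq (h ▸ rfl), fun h => hrC ((hadj _).2 (.inl (h ▸ rfl))),
    fun h => hrC ((hadj _).2 (.inr (h ▸ rfl))), fun a => ?_, fun a => ?_⟩
  · simpa using hG (some a)
  · simpa using hadj (some a)

lemma socket_of_gadget {A : Type} {G : SimpleGraph (Option A)} {a₀ a₁ w : A} (h01 : a₀ ≠ a₁)
    (h0w : a₀ ≠ w) (h1w : a₁ ≠ w) (hG : ∀ a, G.Adj none (some a) ↔ a = a₀ ∨ a = a₁ ∨ a = w)
    {k : ℕ} {H D : SimpleGraph (Option (Fin k))} {b₀ b₁ : Fin k} {W : Set (Fin k)}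
    (g : Gadget H D b₀ b₁ W) : Socket G H a₀ a₁ w b₀ b₁ W :=
  ⟨h01, h0w, h1w, g.b₀₁, g.b₀W, g.b₁W, hG, g.hH⟩

/-- Replacing `v i` by a piece of the Petersen graph increases the degree of `w i` by two. -/
theorem Good.grow [DecidableEq ι] (h : Good ι n f d) (i : ι) :
    Good ι (n + 8) (fun k => f k + if k = 3 then 8 else 0) (Function.update d i (d i + 2)) := by
  classical
  obtain ⟨V, hV, G, C, w, v, h⟩ := h
  obtain ⟨A, hA, e, he, h⟩ := h.exists_option (v i)
  generalize G.comap e = G at h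
  generalize C.comap e = C at h
  have hvi : (e.symm ∘ v) i = none := by simp [← he]
  generalize e.symm ∘ w = w at h
  generalize e.symm ∘ v = v at h hvi
  clear he
  have hwA : ∀ j, ∃ a, w j = some a := fun j =>
    Option.ne_none_iff_exists'.1 (hvi ▸ h.w_ne_v j i)
  choose wA hwA using hwA
  obtain ⟨a₀, a₁, w₀, h01, h0w, h1w, hG, hC⟩ :=
    exists_cubic_nbrs h.uniq.1.1 h.uniq.1.2 (hvi ▸ h.dg_v i)
  -- The edge between `v i` and `w i` is not in `C`, so `w i` is the third neighbour of `v i`, the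
  -- one whose degree the gluing changes.
  have hw₀ : wA i = w₀ := by
    have h1 := h.adj i
    have h2 := h.not_adj i
    rw [hvi, hwA, SimpleGraph.adj_comm] at h1 h2
    rw [hG] at h1
    rw [hC] at h2
    tauto
  have hvA : ∀ j, ∃ a, j ≠ i → v j = some a := by
    intro j
    by_cases hj : j = i
    · exact ⟨a₀, fun h => absurd hj h⟩
    · obtain ⟨a, ha⟩ := Option.ne_none_iff_exists'.1
        (fun hn => hj (h.v_inj (hn.trans hvi.symm)) : v j ≠ none)
      exact ⟨a, fun _ => ha⟩
  choose vA hvA using hvA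
  have s := socket_of_gadget h01 h0w h1w hG gadget_petersen
  have hCw : ¬C.Adj none (some w₀) := by rw [hC]; tauto
  have hdg : ∀ b : Fin 9, dg (ofNb 9 nbPetersen) (some b) = 3 := by
    intro b; rw [dg_eq_card]; revert b; decide +kernel
  have hWc : ({2, 3, 4} : Set (Fin 9)).ncard = 3 :=
    Set.ncard_eq_three.2 ⟨2, 3, 4, by decide, by decide, by decide, rfl⟩
  -- The hub exchanges its edge to `none` for three edges to `W`, a net gain of two.
  have hhub := s.dg_hub
  have hw₀s : some w₀ = w i := by rw [hwA, hw₀]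
  rw [hWc, hw₀s, h.dg_w] at hhub
  -- Vertex 2 of the piece lies in `W`. It is again a cubic neighbour of `w i` along an edge outside
  -- the cycle, so it replaces `v i` and the step can be repeated.
  refine ⟨A ⊕ Fin 9, inferInstance, _, _, fun j => .inl (wA j),
    fun j => if j = i then .inr 2 else .inl (vA j),
    ⟨s.conn ⟨2, by simp⟩ h.conn gadget_petersen.conn, s.uniqueHC_of_uniqueHC gadget_petersen.split
      h.uniq hCw gadget_petersen.le gadget_petersen.isHC gadget_petersen.avoid
      gadget_petersen.uniq, ?_, ?_, ?_, ?_, ?_, ?_, ?_, ?_, ?_⟩⟩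
  · intro j j' hj
    apply h.w_inj
    rw [hwA, hwA, Sum.inl_injective hj]
  · intro j j' hj
    dsimp only at hj
    split_ifs at hj with h1 h2 h2
    · rw [h1, h2]
    · exact h.v_inj (by rw [hvA _ h1, hvA _ h2, Sum.inl_injective hj])
  · intro j j'
    split_ifs with h1
    · simp
    · intro hj
      exact h.w_ne_v j j' (by rw [hwA, hvA _ h1, Sum.inl_injective hj])
  · intro j
    split_ifs with h1
    · rw [h1, hw₀]; exact .inr (.inr ⟨rfl, by simp⟩)
    · have := h.adj j
      rwa [hwA, hvA _ h1] at this
  · intro j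
    split_ifs with h1
    · rw [h1, hw₀]
      rintro (h | h | h)
      exacts [h0w h.1.symm, h1w h.1.symm, h.2]
    · have := h.not_adj j
      rwa [hwA, hvA _ h1] at this
  · intro j
    by_cases hj : j = i
    · subst hj
      rw [Function.update_self, hw₀]
      omega
    · rw [Function.update_of_ne hj, s.dg_inl, ← hwA, h.dg_w]
      rw [← hw₀]
      exact fun h' => hj (h.w_inj (by rw [hwA, hwA, h']))
  · intro j
    split_ifs with h1
    · rw [s.dg_inr, hdg]
    · rw [s.dg_inl, ← hvA _ h1, h.dg_v]
      rw [← hw₀]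
      exact fun h' => h.w_ne_v i j (by rw [hwA, hvA _ h1, h'])
  · intro k
    rw [ncard_sum, ← h.count k, ncard_option]
    have e1 : {a : A | (Sum.inl a : A ⊕ Fin 9) ∉ Set.range (fun j => (Sum.inl (wA j) : A ⊕ Fin 9)) ∧
        dg (glue G (ofNb 9 nbPetersen) (cross a₀ a₁ w₀ 0 1 {2, 3, 4})) (.inl a) = k} =
        {a | some a ∉ Set.range w ∧ dg G (some a) = k} := by
      ext a
      simp only [Set.mem_ofPred_eq, Set.mem_range, Sum.inl.injEq, hwA, Option.some.injEq]
      refine and_congr_right fun ha => ?_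
      rw [s.dg_inl fun h => ha ⟨i, by rw [hw₀, h]⟩]
    have e2 : {b : Fin 9 | (Sum.inr b : A ⊕ Fin 9) ∉ Set.range (fun j => (Sum.inl (wA j) : A ⊕ Fin 9))
        ∧ dg (glue G (ofNb 9 nbPetersen) (cross a₀ a₁ w₀ 0 1 {2, 3, 4})) (.inr b) = k} =
        {b | k = 3} := by
      ext b
      simp only [Set.mem_ofPred_eq, Set.mem_range, s.dg_inr, hdg]
      simp [eq_comm]
    have e3 : (none ∉ Set.range w ∧ dg G none = k) ↔ k = 3 := by
      rw [← hvi, h.dg_v]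
      constructor
      · exact fun h => h.2.symm
      · exact fun hk => ⟨fun ⟨j, hj⟩ => h.w_ne_v j i hj, hk.symm⟩
    rw [e1, e2]
    simp only [e3]
    split_ifs with hk
    · simp [hk, Set.ncard_univ]
    · simp [hk]
  · have := h.card
    rw [Finite.card_option] at this
    rw [Nat.card_sum, Nat.card_fin]
    omega

/-- Replacing a vertex of degree three by a fan creates a vertex of another degree. -/
theorem Good.fan {k : ℕ} {H D : SimpleGraph (Option (Fin (k + 2)))} {b₂ : Fin (k + 2)}
    (g : Gadget H D 0 1 {b₂}) (hdg : ∀ b, b ≠ 0 → dg H (some b) = 3)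
    (hadj : H.Adj (some 0) (some 1)) (hnadj : ¬D.Adj (some 0) (some 1))
    {d : Empty → ℕ} (h : Good Empty n f d) (hf : f 3 ≠ 0) :
    Good Unit (n + k + 1) (fun m => f m + if m = 3 then k else 0)
      (fun _ => dg H (some 0)) := by
  classical
  obtain ⟨V, hV, G, C, w, v, h⟩ := h
  obtain ⟨z, -, hz⟩ := Set.nonempty_of_ncard_ne_zero ((h.count 3).trans_ne hf)
  obtain ⟨A, hA, e, he, h⟩ := h.exists_option z
  rw [← he, ← dg_comap_equiv] at hz
  generalize G.comap e = G at h hz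
  generalize C.comap e = C at h
  generalize e.symm ∘ w = w at h
  generalize e.symm ∘ v = v at h
  clear he
  obtain ⟨a₀, a₁, w₀, h01, h0w, h1w, hG, hC⟩ := exists_cubic_nbrs h.uniq.1.1 h.uniq.1.2 hz
  have s := socket_of_gadget h01 h0w h1w hG g
  have hCw : ¬C.Adj none (some w₀) := by rw [hC]; tauto
  -- As `W` is a single vertex, the hub also exchanges just one edge for one.
  have hinl : ∀ a, dg (glue G H (cross a₀ a₁ w₀ 0 1 {b₂})) (.inl a) = dg G (some a) := by
    intro a
    by_cases ha : a = w₀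
    · have := s.dg_hub
      rw [Set.ncard_singleton] at this
      rw [ha]
      omega
    · exact s.dg_inl ha
  have hmem : ∀ u, (u ∉ Set.range fun _ : Unit => (Sum.inr 0 : A ⊕ Fin (k + 2))) ↔ u ≠ .inr 0 := by
    intro u; simp
  refine ⟨A ⊕ Fin (k + 2), inferInstance, _, _, fun _ => .inr 0, fun _ => .inr 1,
    ⟨s.conn ⟨b₂, rfl⟩ h.conn g.conn, s.uniqueHC_of_uniqueHC g.split h.uniq hCw g.le g.isHC g.avoid
      g.uniq, fun _ _ _ => rfl, fun _ _ _ => rfl, ?_, fun _ => hadj, fun _ => hnadj,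
      fun _ => s.dg_inr 0, fun _ => ?_, ?_, ?_⟩⟩
  · simp
  · rw [s.dg_inr, hdg 1 (by simp)]
  · intro m
    rw [ncard_sum, ← h.count m, ncard_option]
    have e1 : {a : A | (Sum.inl a : A ⊕ Fin (k + 2)) ∉ Set.range (fun _ : Unit => Sum.inr 0) ∧
        dg (glue G H (cross a₀ a₁ w₀ 0 1 {b₂})) (.inl a) = m} =
        {a | some a ∉ Set.range w ∧ dg G (some a) = m} := by
      ext a
      simp [hinl]
    have e2 : {b : Fin (k + 2) | (Sum.inr b : A ⊕ Fin (k + 2)) ∉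
        Set.range (fun _ : Unit => Sum.inr 0) ∧
        dg (glue G H (cross a₀ a₁ w₀ 0 1 {b₂})) (.inr b) = m} = {b | b ≠ 0 ∧ m = 3} := by
      ext b
      rw [Set.mem_ofPred_eq, hmem, s.dg_inr, Set.mem_ofPred_eq]
      simp only [ne_eq, Sum.inr.injEq]
      refine and_congr_right fun hb => ?_
      rw [hdg b hb, eq_comm]
    have e3 : (none ∉ Set.range w ∧ dg G none = m) ↔ m = 3 := by
      rw [hz]; simp [eq_comm]
    rw [e1, e2]
    simp only [e3]
    split_ifs with hk
    · have : {b : Fin (k + 2) | b ≠ 0 ∧ m = 3}.ncard = k + 1 := by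
        have : {b : Fin (k + 2) | b ≠ 0 ∧ m = 3} = Set.univ \ {0} := by ext; simp [hk]
        rw [this, Set.ncard_sdiff_singleton_of_mem (Set.mem_univ _), Set.ncard_univ, Nat.card_fin]
        rfl
      omega
    · simp [hk]
  · have := h.card
    rw [Finite.card_option] at this
    rw [Nat.card_sum, Nat.card_fin]
    omega

/-- Forget the special vertices of a good graph. -/
theorem Good.forget [Finite ι] (h : Good ι n f d) (d' : Empty → ℕ) :
    Good Empty n (fun k => f k + {i | d i = k}.ncard) d' := by
  obtain ⟨V, hV, G, C, w, v, h⟩ := h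
  refine ⟨V, hV, G, C, Empty.elim, Empty.elim, ⟨h.conn, h.uniq, fun i => i.elim, fun i => i.elim,
    fun i => i.elim, fun i => i.elim, fun i => i.elim, fun i => i.elim, fun i => i.elim, ?_,
    h.card⟩⟩
  intro k
  have hs : {u | u ∉ Set.range (Empty.elim : Empty → V) ∧ dg G u = k} =
      {u | u ∉ Set.range w ∧ dg G u = k} ∪ w '' {i | d i = k} := by
    ext u
    simp only [Set.mem_ofPred_eq, Set.mem_union, Set.mem_image]
    constructor
    · rintro ⟨-, hu⟩
      by_cases hw : u ∈ Set.range w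
      · obtain ⟨i, rfl⟩ := hw
        exact .inr ⟨i, (h.dg_w i).symm.trans hu, rfl⟩
      · exact .inl ⟨hw, hu⟩
    · rintro (⟨-, hu⟩ | ⟨i, hi, rfl⟩)
      · exact ⟨by simp, hu⟩
      · exact ⟨by simp, (h.dg_w i).trans hi⟩
  have hd : Disjoint {u | u ∉ Set.range w ∧ dg G u = k} (w '' {i | d i = k}) := by
    rw [Set.disjoint_left]
    rintro _ ⟨h1, -⟩ ⟨i, -, rfl⟩
    exact h1 ⟨i, rfl⟩
  rw [hs, Set.ncard_union_eq hd (Set.toFinite _) (Set.toFinite _), h.count,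
    Set.ncard_image_of_injective _ h.w_inj]

/-- A uniquely hamiltonian graph with two vertices of degree four and `22` vertices of degree
three. -/
theorem good_base : Good Bool 24 (fun k => if k = 3 then 22 else 0) (fun _ => 4) := by
  -- The copies are joined crosswise: vertex 0 of each, whose edge to `none` is in all hamiltonian
  -- cycles, is joined to vertex 1 of the other. By `base_hub` the left copy forces one of these
  -- edges and the right copy the other.
  have s : Socket (ofNb 12 nbBase) (ofNb 12 nbBase) 0 1 2 1 0 {2} :=
    socket_of_gadget (by decide) (by decide) (by decide) base_none gadget_base
  set L := [1, 11, 9, 4, 12, 7, 8, 10, 5, 3, 6, 2, 0] with hL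
  have hu := s.uniqueHC gadget_base.split (C₁ := ofList 12 L) (C₂ := ofList 12 L) gadget_base.le
    gadget_base.isHC (gadget_base.avoid 2 rfl)
    (fun C hC hC' h => gadget_base.uniq C hC hC' (by simpa using h))
    gadget_base.le gadget_base.isHC gadget_base.avoid gadget_base.uniq
    (fun C hC _ _ hC' _ h => absurd (base_hub hC hC') h)
    (fun _ _ D hD _ hD' _ => base_hub hD hD')
  have hadj : (ofNb 12 nbBase).Adj (some 0) (some 9) := by decide +kernel
  have hnadj : ¬(ofList 12 L).Adj (some 0) (some 9) := by decide +kernel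
  have hdg0 : dg (ofNb 12 nbBase) (some 0) = 4 := by rw [dg_eq_card]; decide +kernel
  have hdg : ∀ b : Fin 12, b ≠ 0 → dg (ofNb 12 nbBase) (some b) = 3 := by
    intro b; rw [dg_eq_card]; revert b; decide +kernel
  have hinl : ∀ a, dg (glue (ofNb 12 nbBase) (ofNb 12 nbBase) (cross 0 1 2 1 0 {2})) (.inl a) =
      dg (ofNb 12 nbBase) (some a) := by
    intro a
    by_cases ha : a = 2
    · have := s.dg_hub
      rw [Set.ncard_singleton] at this
      rw [ha]
      omega
    · exact s.dg_inl ha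
  let w : Bool → Fin 12 ⊕ Fin 12 := fun i => if i then .inl 0 else .inr 0
  let v : Bool → Fin 12 ⊕ Fin 12 := fun i => if i then .inl 9 else .inr 9
  have hmem : ∀ u, u ∉ Set.range w ↔ u ≠ .inl 0 ∧ u ≠ .inr 0 := by
    intro u
    simp [w, and_comm]
  refine ⟨Fin 12 ⊕ Fin 12, inferInstance, _, _, w, v, ⟨s.conn ⟨2, rfl⟩ gadget_base.conn
    gadget_base.conn, hu, by decide, by decide, by decide, ?_, ?_, ?_, ?_, ?_, ?_⟩⟩
  · rintro (_ | _) <;> exact hadj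
  · rintro (_ | _) <;> exact hnadj
  · rintro (_ | _)
    · exact (s.dg_inr 0).trans hdg0
    · exact (hinl 0).trans hdg0
  · rintro (_ | _)
    · exact (s.dg_inr 9).trans (hdg 9 (by decide))
    · exact (hinl 9).trans (hdg 9 (by decide))
  · intro k
    have hcount : {b : Fin 12 | b ≠ 0 ∧ k = 3}.ncard = if k = 3 then 11 else 0 := by
      split_ifs with hk
      · have : {b : Fin 12 | b ≠ 0 ∧ k = 3} = Set.univ \ {0} := by ext; simp [hk]
        rw [this, Set.ncard_sdiff_singleton_of_mem (Set.mem_univ _), Set.ncard_univ, Nat.card_fin]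
      · simp [hk]
    have hdgk : ∀ b : Fin 12, (b ≠ 0 ∧ dg (ofNb 12 nbBase) (some b) = k) ↔ (b ≠ 0 ∧ k = 3) :=
      fun b => and_congr_right fun hb => by rw [hdg b hb, eq_comm]
    rw [ncard_sum]
    simp only [hmem, hinl, s.dg_inr]
    simp only [ne_eq, Sum.inl.injEq, Sum.inr.injEq, reduceCtorEq, not_false_eq_true, and_true,
      true_and]
    simp only [← ne_eq, hdgk, hcount]
    split_ifs <;> rfl
  · simp

end Good

/-! ### Realizing degree sets -/

/-- Uniquely hamiltonian graphs with `n` vertices, of which `f k` have degree `k`, that stay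
connected if two vertices are deleted. -/
abbrev GoodCount (n : ℕ) (f : ℕ → ℕ) : Prop := Good Empty n f fun _ => 0

/-- Graphs with a vertex of degree three can be enlarged by `m` vertices, of which `g k` have degree
`k`, without changing other degrees. -/
def Enlarge (m : ℕ) (g : ℕ → ℕ) : Prop :=
  ∀ n f, GoodCount n f → f 3 ≠ 0 → GoodCount (n + m) (f + g)

lemma Enlarge.zero : Enlarge 0 0 := fun _ _ h _ => h

lemma Enlarge.add {m m' : ℕ} {g g' : ℕ → ℕ} (h : Enlarge m g) (h' : Enlarge m' g') :
    Enlarge (m + m') (g + g') := fun n f hf h3 => by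
  rw [← add_assoc, ← add_assoc]
  refine h' _ _ (h n f hf h3) ?_
  rw [Pi.add_apply]; omega

lemma Enlarge.nsmul {m : ℕ} {g : ℕ → ℕ} (h : Enlarge m g) (i : ℕ) : Enlarge (i * m) (i • g) := by
  induction i with
  | zero => simpa using Enlarge.zero
  | succ i ih =>
    rw [Nat.succ_mul, succ_nsmul]
    exact ih.add h

lemma Good.congr {ι : Type} {n n' : ℕ} {f f' : ℕ → ℕ} {d d' : ι → ℕ} (h : Good ι n f d)
    (hn : n = n') (hf : ∀ k, f k = f' k) (hd : ∀ i, d i = d' i) : Good ι n' f' d' := by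
  rwa [← hn, ← funext hf, ← funext hd]

lemma Good.grow_iterate {ι : Type} [DecidableEq ι] {n : ℕ} {f : ℕ → ℕ} {d : ι → ℕ}
    (h : Good ι n f d) (i : ι) (j : ℕ) : Good ι (n + 8 * j)
      (fun k => f k + if k = 3 then 8 * j else 0) (Function.update d i (d i + 2 * j)) := by
  induction j with
  | zero => simpa using h
  | succ j ih =>
    refine (ih.grow i).congr (by omega) (fun k => ?_) fun i' => ?_
    · split_ifs <;> omega
    · simp only [Function.update_self, Function.update_idem]
      congr 1

lemma exists_enlarge_of_good_unit {D n₀ m₀ : ℕ}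
    (h : ∀ n f, GoodCount n f → f 3 ≠ 0 →
      Good Unit (n + m₀) (fun m => f m + if m = 3 then n₀ else 0) fun _ => D) (j : ℕ) :
    Enlarge (m₀ + 8 * j)
      ((fun k => if k = 3 then n₀ + 8 * j else 0) + fun k => if k = D + 2 * j then 1 else 0) := by
  intro n f hf h3
  refine (((h n f hf h3).grow_iterate () j).forget fun _ => 0).congr (by omega) (fun k => ?_)
    fun _ => rfl
  simp only [Pi.add_apply, Function.update_self]
  have : {i : Unit | D + 2 * j = k}.ncard = if k = D + 2 * j then 1 else 0 := by
    simp only [eq_comm (b := k)]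
    split_ifs with hk <;> simp [hk, Set.ncard_univ]
  rw [this]
  split_ifs <;> omega

/-- Growth preserves the parity of a degree, so an even `D` starts from the hub of the wheel, of
degree 4, and an odd `D` from a triangle vertex, of degree 3. -/
lemma exists_enlarge {D : ℕ} (hD : 3 ≤ D) :
    ∃ m e, 0 < m ∧ Enlarge m ((fun k => if k = 3 then e else 0) + fun k => if k = D then 1 else 0) := by
  rcases Nat.even_or_odd' D with ⟨c, hc | hc⟩
  · have h0 : dg (ofNb 4 nbWheel) (some 0) = 4 := by rw [dg_eq_card]; decide +kernel
    have hdg : ∀ b : Fin 4, b ≠ 0 → dg (ofNb 4 nbWheel) (some b) = 3 := by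
      intro b; rw [dg_eq_card]; revert b; decide +kernel
    refine ⟨3 + 8 * (c - 2), 2 + 8 * (c - 2), by omega, ?_⟩
    · rw [show D = 4 + 2 * (c - 2) by omega]
      exact exists_enlarge_of_good_unit (n₀ := 2) (m₀ := 3)
        (fun n f hf h3 => (Good.fan gadget_wheel hdg (by decide +kernel) (by decide +kernel) hf
          h3).congr rfl (fun _ => rfl) fun _ => h0) (c - 2)
  · have h0 : dg (ofNb 3 nbTriangle) (some 0) = 3 := by rw [dg_eq_card]; decide +kernel
    have hdg : ∀ b : Fin 3, b ≠ 0 → dg (ofNb 3 nbTriangle) (some b) = 3 := by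
      intro b; rw [dg_eq_card]; revert b; decide +kernel
    refine ⟨2 + 8 * (c - 1), 1 + 8 * (c - 1), by omega, ?_⟩
    · rw [show D = 3 + 2 * (c - 1) by omega]
      exact exists_enlarge_of_good_unit (n₀ := 1) (m₀ := 2)
        (fun n f hf h3 => (Good.fan gadget_triangle hdg (by decide +kernel) (by decide +kernel) hf
          h3).congr rfl (fun _ => rfl) fun _ => h0) (c - 1)

lemma exists_enlarge_list (l : List ℕ) (hl : ∀ D ∈ l, 3 ≤ D) :
    ∃ m g, l.length ≤ m ∧ Enlarge m g ∧ (∀ k ∈ l, g k ≠ 0) ∧ ∀ k, g k ≠ 0 → k = 3 ∨ k ∈ l := by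
  induction l with
  | nil => exact ⟨0, 0, le_rfl, Enlarge.zero, by simp, by simp⟩
  | cons D l ih =>
    obtain ⟨m, g, h1, h2, h3, h4⟩ := ih fun D hD => hl D (by simp [hD])
    obtain ⟨m', e, h5, h6⟩ := exists_enlarge (hl D (by simp))
    refine ⟨_, _, ?_, h2.add h6, ?_, ?_⟩
    · rw [List.length_cons]; omega
    · intro k hk
      rcases List.mem_cons.1 hk with rfl | hk
      · simp
      · have := h3 k hk
        simp [this]
    · intro k hk
      by_contra hcon
      rw [List.mem_cons, not_or, not_or] at hcon
      have : g k = 0 := by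
        by_contra hg
        rcases h4 k hg with h | h
        exacts [hcon.1 h, hcon.2.2 h]
      simp [this, hcon.1, hcon.2.1] at hk

/-- Both vertices of degree 4 in the base graph are grown to degree `D`, so that no degree 4 is left
over. This is where evenness enters the construction. -/
lemma exists_goodCount_even {D : ℕ} (hD : Even D) (h4 : 4 ≤ D) :
    ∃ n f, GoodCount n f ∧ ∀ k, f k ≠ 0 ↔ k = 3 ∨ k = D := by
  obtain ⟨c, rfl⟩ := hD
  have h := ((good_base.grow_iterate true (c - 2)).grow_iterate false (c - 2)).forget fun _ => 0
  refine ⟨_, _, h, fun k => ?_⟩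
  have e1 : ∀ i : Bool, Function.update (Function.update (fun _ : Bool => 4) true (4 + 2 * (c - 2)))
      false (Function.update (fun _ : Bool => 4) true (4 + 2 * (c - 2)) false + 2 * (c - 2)) i =
        c + c := by
    rintro (_ | _) <;> simp [Function.update] <;> omega
  simp only [e1]
  by_cases hk : k = c + c
  · simp [hk]
  · by_cases hk3 : k = 3
    · simp [hk3]
    · simp [hk, hk3, Ne.symm hk]

lemma exists_goodCount {M : Finset ℕ} (hM : IsLeast (M : Set ℕ) 3) (hE : ∃ d ∈ M, Even d) :
    ∃ n f, GoodCount n f ∧ ∀ k, f k ≠ 0 ↔ k ∈ M := by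
  obtain ⟨D, hDM, hD⟩ := hE
  have h3 : ∀ k ∈ M, 3 ≤ k := fun k hk => hM.2 hk
  have hD4 : 4 ≤ D := by
    obtain ⟨c, rfl⟩ := hD
    have := h3 _ hDM
    omega
  obtain ⟨n, f, hf, hfk⟩ := exists_goodCount_even hD hD4
  obtain ⟨m, g, -, h2, hg, hg'⟩ := exists_enlarge_list M.toList fun k hk => h3 k (by simpa using hk)
  refine ⟨_, _, h2 n f hf ((hfk 3).2 (.inl rfl)), fun k => ?_⟩
  have hg0 : g k ≠ 0 ↔ k ∈ M := by
    constructor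
    · intro h
      rcases hg' k h with rfl | h
      exacts [hM.1, by simpa using h]
    · exact fun h => hg k (by simpa using h)
  have hf0 : f k ≠ 0 → k ∈ M := by
    rw [hfk]
    rintro (rfl | rfl)
    exacts [hM.1, hDM]
  rw [Pi.add_apply]
  constructor
  · intro h
    by_cases h' : g k = 0
    · exact hf0 (by omega)
    · exact hg0.1 h'
  · intro h
    have := hg0.2 h
    omega

lemma numDegree_eq {V : Type} [Fintype V] (G : SimpleGraph V) (k : ℕ) :
    numDegree G k = {u | dg G u = k}.ncard := by
  classical
  rw [numDegree, ← Set.ncard_coe_finset]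
  congr 1
  ext u
  simp [degree_eq_dg]

lemma degreeSet_eq {V : Type} [Fintype V] (G : SimpleGraph V) :
    degreeSet G = Set.range (dg G) := by
  rw [degreeSet]
  congr 1
  ext u
  classical
  convert degree_eq_dg G u

theorem GoodCount.exists_realizes {n : ℕ} {f : ℕ → ℕ} (h : GoodCount n f) {M : Finset ℕ}
    (h2 : 2 ∉ M) (h3 : 3 ∈ M) (hf : ∀ k, f k ≠ 0 ↔ k ∈ M) :
    ∃ (V : Type) (_ : Fintype V) (G : SimpleGraph V), Realizes G M ∧ Fintype.card V = n ∧
      ∀ k, numDegree G k = f k := by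
  obtain ⟨V, hV, G, C, w, v, h⟩ := h
  have hcount : ∀ k, {u | dg G u = k}.ncard = f k := by
    intro k
    rw [← h.count k]
    congr 1
    ext u
    simp
  let _ := Fintype.ofFinite V
  refine ⟨V, inferInstance, G, ⟨?_, ?_, ?_⟩, ?_, ?_⟩
  · rw [if_neg h2, isKConnected_three_iff]
    refine ⟨?_, h.conn⟩
    obtain ⟨z, hz⟩ := Set.nonempty_of_ncard_ne_zero ((hcount 3).trans_ne ((hf 3).2 h3))
    rw [← Nat.card_eq_fintype_card, ← Set.ncard_univ]
    have hz' : dg G z = 3 := hz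
    rw [dg] at hz'
    rw [← hz']
    refine Set.ncard_lt_ncard (Set.ssubset_univ_iff.2 fun hu => ?_) (Set.toFinite _)
    exact G.irrefl (show z ∈ G.neighborSet z from hu ▸ Set.mem_univ z)
  · exact (isUniquelyHamiltonian_iff G).2 ⟨C, h.uniq⟩
  · rw [degreeSet_eq]
    ext k
    rw [Finset.mem_coe, ← hf, ← hcount, ← Nat.pos_iff_ne_zero,
      Set.ncard_pos (Set.toFinite _)]
    rfl
  · rw [← Nat.card_eq_fintype_card, h.card]
  · intro k; rw [numDegree_eq, hcount]

theorem uhcRealizable_of_even {M : Finset ℕ} (hM : IsLeast (M : Set ℕ) 3) (hE : ∃ d ∈ M, Even d) :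
    UhcRealizable M := by
  obtain ⟨n, f, hf, hk⟩ := exists_goodCount hM hE
  obtain ⟨V, hV, G, hG, -⟩ := hf.exists_realizes (fun h => absurd (hM.2 h) (by decide)) hM.1 hk
  exact ⟨V, hV, G, hG⟩

theorem stronglyUhcRealizable_of_even {M : Finset ℕ} (hM : IsLeast (M : Set ℕ) 3)
    (hE : ∃ d ∈ M, Even d) : StronglyUhcRealizable M := by
  have h3 : ∀ k ∈ M, 3 ≤ k := fun k hk => hM.2 hk
  have hne : M.Nonempty := ⟨3, hM.1⟩
  have hmin : M.min' hne = 3 := le_antisymm (M.min'_le 3 hM.1) (hM.2 (M.min'_mem hne))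
  refine ⟨hne, ?_, fun D₁ D₂ hdisj hunion => ?_⟩
  · obtain ⟨D, hDM, hD⟩ := hE
    exact Finset.one_lt_card.2 ⟨3, hM.1, D, hDM, by rintro rfl; exact absurd hD (by decide)⟩
  rw [hmin] at hunion
  have hD₂ : ∀ k ∈ D₂, k ∈ M := fun k hk =>
    Finset.mem_of_mem_erase (hunion ▸ Finset.mem_union_right D₁ hk)
  have hD₁ : ∀ k ∈ D₁, k ≠ 3 ∧ k ∉ D₂ := fun k hk =>
    ⟨Finset.ne_of_mem_erase (hunion ▸ Finset.mem_union_left D₂ hk),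
      Finset.disjoint_left.1 hdisj hk⟩
  obtain ⟨n, f, hf, hfk⟩ := exists_goodCount hM hE
  -- The entry 3 makes the enlargement proper even if `D₂` is empty.
  obtain ⟨m, g, hm, hmg, hg, hg'⟩ := exists_enlarge_list (3 :: D₂.toList) (by
    intro k hk
    rcases List.mem_cons.1 hk with rfl | hk
    exacts [le_rfl, h3 k (hD₂ k (by simpa using hk))])
  have hm0 : 0 < m := by rw [List.length_cons] at hm; omega
  have hgM : ∀ k, g k ≠ 0 → k = 3 ∨ k ∈ D₂ := by
    intro k hk
    rcases hg' k hk with h | h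
    · exact .inl h
    · simpa using h
  have hreal : ∀ i : ℕ, ∃ (V : Type) (_ : Fintype V) (G : SimpleGraph V), Realizes G M ∧
      Fintype.card V = n + i * m ∧ ∀ k, numDegree G k = (f + i • g) k := by
    intro i
    refine ((hmg.nsmul i) n f hf ((hfk 3).2 hM.1)).exists_realizes
      (fun h => absurd (h3 2 h) (by decide)) hM.1 fun k => ?_
    simp only [Pi.add_apply, Pi.smul_apply, smul_eq_mul]
    constructor
    · intro h
      by_cases hk : g k = 0
      · rw [hk] at h
        exact (hfk k).1 (by simpa using h)
      · rcases hgM k hk with rfl | hk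
        exacts [hM.1, hD₂ k hk]
    · intro h
      have := (hfk k).2 h
      omega
  choose V hV G hG hcard hnum using hreal
  -- On `D₁` the increment `g` vanishes, so the counts remain those of `f`. For `D₂` each count is
  -- at least `1 + i`, while `n + i * m ≤ (n + m) * (1 + i)`.
  refine ⟨D₁.sup f, 1 / ((n : ℝ) + m), by positivity, V, hV, G, ?_, fun i => ⟨hG i, ?_, ?_⟩⟩
  · intro i j hij
    simp only [hcard]
    have := Nat.mul_lt_mul_of_pos_right hij hm0
    omega
  · intro k hk
    have hgk : g k = 0 := by
      by_contra h
      rcases hgM k h with h | h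
      exacts [(hD₁ k hk).1 h, (hD₁ k hk).2 h]
    rw [hnum]
    simpa [hgk] using Finset.le_sup (f := f) hk
  · intro k hk
    have h1 : 1 ≤ f k := Nat.one_le_iff_ne_zero.2 ((hfk k).2 (hD₂ k hk))
    have h2 : 1 ≤ g k := Nat.one_le_iff_ne_zero.2 (hg k (by simp [hk]))
    have h3 : 1 + i ≤ numDegree (G i) k := by
      rw [hnum]
      simp only [Pi.add_apply, Pi.smul_apply, smul_eq_mul]
      have := Nat.mul_le_mul_left i h2
      omega
    have h4 : (1 + i : ℝ) ≤ numDegree (G i) k := by exact_mod_cast h3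
    refine le_trans ?_ h4
    rw [hcard, one_div, inv_mul_le_iff₀ (by positivity)]
    push_cast
    have hn : (0 : ℝ) ≤ n * i := by positivity
    have hm : (0 : ℝ) ≤ m := by positivity
    nlinarith

/-! ### Rotations of hamiltonian paths -/

section Rotation

variable {m : ℕ}

/-- Reversal of the part of `0, …, m + 2` that follows `i`. -/
def tailRev (i j : Fin (m + 3)) : Fin (m + 3) :=
  if h : j ≤ i then j else ⟨i + 1 + (m + 2) - j, by
    have := Fin.lt_def.1 (not_le.1 h); omega⟩

lemma tailRev_of_le {i j : Fin (m + 3)} (h : j ≤ i) : tailRev i j = j := dif_pos h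

lemma val_tailRev_of_lt {i j : Fin (m + 3)} (h : i < j) :
    (tailRev i j : ℕ) = i + 1 + (m + 2) - j := by
  rw [tailRev, dif_neg (not_le.2 h)]

lemma tailRev_tailRev (i j : Fin (m + 3)) : tailRev i (tailRev i j) = j := by
  by_cases h : j ≤ i
  · rw [tailRev_of_le h, tailRev_of_le h]
  · have h := not_le.1 h
    have hj := j.2
    have hlt := Fin.lt_def.1 h
    have h1 := val_tailRev_of_lt h
    have h2 : i < tailRev i j := by rw [Fin.lt_def]; omega
    ext
    rw [val_tailRev_of_lt h2]
    omega

/-- `tailRev` as a permutation. -/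
def tailRevPerm (i : Fin (m + 3)) : Equiv.Perm (Fin (m + 3)) where
  toFun := tailRev i
  invFun := tailRev i
  left_inv := tailRev_tailRev i
  right_inv := tailRev_tailRev i

variable {V : Type} (G : SimpleGraph V) (x y : V)

/-- Hamiltonian paths starting with the vertices `x` and `y`. -/
def IsHamPath (σ : Fin (m + 3) ≃ V) : Prop :=
  σ 0 = x ∧ σ 1 = y ∧ ∀ i j : Fin (m + 3), (j : ℕ) = i + 1 → G.Adj (σ i) (σ j)

variable {G x y}

/-- The reversal breaks only the edge behind position `i` and replaces it by the edge from `σ i` to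
the old last vertex. The bound `1 ≤ i` protects the first two vertices. -/
lemma IsHamPath.rotate {σ : Fin (m + 3) ≃ V} (h : IsHamPath G x y σ) {i : Fin (m + 3)}
    (h1 : 1 ≤ (i : ℕ)) (h2 : (i : ℕ) ≤ m) (hadj : G.Adj (σ i) (σ (Fin.last _))) :
    IsHamPath G x y ((tailRevPerm i).trans σ) := by
  have hap : ∀ j, ((tailRevPerm i).trans σ) j = σ (tailRev i j) := fun j => rfl
  refine ⟨?_, ?_, fun j k hjk => ?_⟩
  · rw [hap, tailRev_of_le (Fin.zero_le i), h.1]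
  · rw [hap, tailRev_of_le (by rw [Fin.le_def]; simpa using h1), h.2.1]
  · rw [hap, hap]
    by_cases hk : k ≤ i
    · have hk' := Fin.le_def.1 hk
      rw [tailRev_of_le hk, tailRev_of_le (Fin.le_def.2 (by omega))]
      exact h.2.2 j k hjk
    · have hk := not_le.1 hk
      have hk' := Fin.lt_def.1 hk
      have hk2 := k.2
      have hkv := val_tailRev_of_lt hk
      by_cases hj : j ≤ i
      · have hj' := Fin.le_def.1 hj
        rw [tailRev_of_le hj]
        have e1 : j = i := Fin.ext (by omega)
        have e2 : tailRev i k = Fin.last _ := Fin.ext (by rw [hkv, Fin.val_last]; omega)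
        rw [e1, e2]
        exact hadj
      · have hj := not_le.1 hj
        have hj' := Fin.lt_def.1 hj
        have hjv := val_tailRev_of_lt hj
        exact (h.2.2 _ _ (by omega)).symm

lemma tailRev_last {i : Fin (m + 3)} (h2 : (i : ℕ) ≤ m) :
    (tailRev i (Fin.last _) : ℕ) = i + 1 := by
  rw [val_tailRev_of_lt (Fin.lt_def.2 (by rw [Fin.val_last]; omega)), Fin.val_last]
  omega

open Classical in
/-- If all degrees are odd, the number of hamiltonian paths starting with a given edge and extending
to a hamiltonian cycle is even. -/
theorem even_card_closed_paths [Fintype V] (hodd : ∀ v, Odd (dg G v)) :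
    Even (Finset.univ.filter fun σ : Fin (m + 3) ≃ V =>
      IsHamPath G x y σ ∧ G.Adj (σ 0) (σ (Fin.last _))).card := by
  let P : Finset (Fin (m + 3) ≃ V) := Finset.univ.filter (IsHamPath G x y)
  let I : (Fin (m + 3) ≃ V) → Finset (Fin (m + 3)) := fun σ =>
    Finset.univ.filter fun i => 1 ≤ (i : ℕ) ∧ (i : ℕ) ≤ m ∧ G.Adj (σ i) (σ (Fin.last _))
  -- Rotating at the same index again undoes a rotation, and no pair is fixed because the new last
  -- vertex was at position `i + 1 ≤ m + 1`.
  have hrot : ∑ p ∈ P.sigma I, (1 : ZMod 2) = 0 := by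
    have hmem : ∀ p : (_ : Fin (m + 3) ≃ V) × Fin (m + 3), p ∈ P.sigma I ↔ IsHamPath G x y p.1 ∧
        1 ≤ (p.2 : ℕ) ∧ (p.2 : ℕ) ≤ m ∧ G.Adj (p.1 p.2) (p.1 (Fin.last _)) := by
      intro p; simp [P, I]
    refine Finset.sum_involution (fun p _ => ⟨(tailRevPerm p.2).trans p.1, p.2⟩) ?_ ?_ ?_ ?_
    · intro p hp; decide
    · rintro ⟨σ, i⟩ hp - heq
      obtain ⟨-, h1, h2, -⟩ := (hmem _).1 hp
      have h3 := congrArg (fun τ : Fin (m + 3) ≃ V => τ (Fin.last _)) (Sigma.mk.inj heq).1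
      have h4 : tailRev i (Fin.last _) = Fin.last _ := σ.injective h3
      change (i : ℕ) ≤ m at h2
      have h5 := tailRev_last h2
      have h6 := congrArg Fin.val h4
      rw [Fin.val_last] at h6
      omega
    · rintro ⟨σ, i⟩ hp
      obtain ⟨h0, h1, h2, h3⟩ := (hmem _).1 hp
      refine (hmem _).2 ⟨h0.rotate h1 h2 h3, h1, h2, ?_⟩
      change G.Adj (σ (tailRev i i)) (σ (tailRev i (Fin.last _)))
      rw [tailRev_of_le le_rfl]
      exact h0.2.2 _ _ (tailRev_last h2)
    · rintro ⟨σ, i⟩ hp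
      refine Sigma.ext (Equiv.ext fun j => ?_) HEq.rfl
      change σ (tailRev i (tailRev i j)) = σ j
      rw [tailRev_tailRev]
  -- The neighbours of the last vertex are its predecessor `q`, those that allow a rotation, and
  -- possibly the first vertex. Their total is odd, so the last two kinds together are even in
  -- number.
  have hI : ∀ σ ∈ P, ((I σ).card : ZMod 2) = if G.Adj (σ 0) (σ (Fin.last _)) then 1 else 0 := by
    intro σ hσ
    have hσ : IsHamPath G x y σ := (Finset.mem_filter.1 hσ).2
    let N : Finset (Fin (m + 3)) := Finset.univ.filter fun i => G.Adj (σ i) (σ (Fin.last _))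
    have hN : N.card = dg G (σ (Fin.last _)) := by
      rw [dg_eq_card]
      refine Finset.card_equiv σ fun i => ?_
      simp [N, SimpleGraph.adj_comm]
    let Z : Finset (Fin (m + 3)) := if G.Adj (σ 0) (σ (Fin.last _)) then {0} else ∅
    let q : Fin (m + 3) := ⟨m + 1, by omega⟩
    have hq : G.Adj (σ q) (σ (Fin.last _)) := hσ.2.2 _ _ (by simp [q])
    have hsplit : N = insert q (I σ ∪ Z) := by
      ext i
      have hi := i.2
      simp only [N, I, Z, Finset.mem_filter, Finset.mem_univ, true_and, Finset.mem_insert,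
        Finset.mem_union]
      constructor
      · intro h
        by_cases h0 : (i : ℕ) = 0
        · have : i = 0 := Fin.ext h0
          subst this
          simp [h]
        · by_cases h1 : (i : ℕ) ≤ m
          · exact .inr (.inl ⟨by omega, h1, h⟩)
          · have h2 : (i : ℕ) ≠ m + 2 := fun h2 => by
              have : i = Fin.last _ := Fin.ext h2
              rw [this] at h
              exact G.irrefl h
            exact .inl (Fin.ext (by simp only [q]; omega))
      · rintro (rfl | ⟨-, -, h⟩ | h)
        · exact hq
        · exact h
        · split_ifs at h with h'
          · rw [Finset.mem_singleton.1 h]; exact h'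
          · simp at h
    have hd1 : q ∉ I σ ∪ Z := by
      simp only [I, Z, Finset.mem_union, Finset.mem_filter, Finset.mem_univ, true_and, not_or]
      refine ⟨fun h => ?_, ?_⟩
      · have := h.2.1
        simp only [q] at this
        omega
      · split_ifs <;> simp [q, Fin.ext_iff]
    have hd2 : Disjoint (I σ) Z := by
      rw [Finset.disjoint_left]
      intro i hi hZ
      have h1 := (Finset.mem_filter.1 hi).2.1
      simp only [Z] at hZ
      split_ifs at hZ with h'
      · rw [Finset.mem_singleton.1 hZ] at h1
        simp at h1
      · simp at hZ
    have hcard : N.card = (I σ).card + Z.card + 1 := by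
      rw [hsplit, Finset.card_insert_of_notMem hd1, Finset.card_union_of_disjoint hd2]
    obtain ⟨c, hc⟩ := hodd (σ (Fin.last _))
    have hsum : (I σ).card + Z.card = 2 * c := by omega
    have hZ : Z.card = if G.Adj (σ 0) (σ (Fin.last _)) then 1 else 0 := by
      simp only [Z]
      split_ifs <;> rfl
    have h2 : (((I σ).card + Z.card : ℕ) : ZMod 2) = 0 := by
      rw [hsum, ZMod.natCast_eq_zero_iff]
      exact ⟨c, rfl⟩
    rw [Nat.cast_add, hZ] at h2
    have h3 := eq_neg_of_add_eq_zero_left h2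
    rw [h3, ZMod.neg_eq_self_mod_two]
    split_ifs <;> simp
  rw [← ZMod.natCast_eq_zero_iff_even, ← hrot, Finset.sum_sigma]
  simp only [Finset.sum_const, nsmul_eq_mul, mul_one]
  rw [Finset.sum_congr rfl hI, Finset.sum_boole, Finset.filter_filter]

end Rotation

/-! ### Graphs with only odd degrees are not uniquely hamiltonian -/

section Thomason

variable {V : Type} {m : ℕ}

lemma isHC_cycleGraph : IsHC (V := Fin (m + 3)) (SimpleGraph.cycleGraph (m + 3)) :=
  ⟨SimpleGraph.cycleGraph_connected, fun v => by
    rw [← degree_eq_dg, SimpleGraph.cycleGraph_degree_three_le]⟩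

lemma val_sub_eq_one {u v : Fin (m + 3)} :
    ((v - u : Fin (m + 3)) : ℕ) = 1 ↔ (v : ℕ) = u + 1 ∨ (v = 0 ∧ u = Fin.last _) := by
  have hu := u.2
  have hv := v.2
  rcases le_or_gt u v with h | h
  · rw [Fin.coe_sub_iff_le.2 h]
    have := Fin.le_def.1 h
    constructor
    · intro h; left; omega
    · rintro (h | ⟨rfl, rfl⟩)
      · omega
      · simp at h
  · rw [Fin.coe_sub_iff_lt.2 h]
    have := Fin.lt_def.1 h
    constructor
    · intro h; right
      exact ⟨Fin.ext (by rw [Fin.val_zero]; omega), Fin.ext (by rw [Fin.val_last]; omega)⟩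
    · rintro (h | ⟨rfl, rfl⟩)
      · omega
      · rw [Fin.val_zero, Fin.val_last]; omega

lemma cycleGraph_adj_iff_val {u v : Fin (m + 3)} : (SimpleGraph.cycleGraph (m + 3)).Adj u v ↔
    ((u : ℕ) = v + 1 ∨ (u = 0 ∧ v = Fin.last _)) ∨ (v : ℕ) = u + 1 ∨ (v = 0 ∧ u = Fin.last _) := by
  rw [SimpleGraph.cycleGraph_adj', val_sub_eq_one, val_sub_eq_one]

/-- The cycle visiting the vertices in the order given by `σ`. -/
def cycOf (σ : Fin (m + 3) ≃ V) : SimpleGraph V :=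
  (SimpleGraph.cycleGraph (m + 3)).comap σ.symm

lemma cycOf_adj (σ : Fin (m + 3) ≃ V) (i j : Fin (m + 3)) :
    (cycOf σ).Adj (σ i) (σ j) ↔ (SimpleGraph.cycleGraph (m + 3)).Adj i j := by
  simp [cycOf]

lemma cycOf_le {G : SimpleGraph V} {x y : V} {σ : Fin (m + 3) ≃ V} (h : IsHamPath G x y σ)
    (hlast : G.Adj (σ 0) (σ (Fin.last _))) : cycOf σ ≤ G := by
  intro u v huv
  obtain ⟨i, rfl⟩ := σ.surjective u
  obtain ⟨j, rfl⟩ := σ.surjective v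
  rw [cycOf_adj, cycleGraph_adj_iff_val] at huv
  rcases huv with (h1 | ⟨rfl, rfl⟩) | h1 | ⟨rfl, rfl⟩
  · exact (h.2.2 _ _ h1).symm
  · exact hlast
  · exact h.2.2 _ _ h1
  · exact hlast.symm

/-- A cycle together with an oriented edge of it determines the order of the vertices. -/
lemma eq_of_cycOf_eq {σ τ : Fin (m + 3) ≃ V} (h : cycOf σ = cycOf τ) (h0 : σ 0 = τ 0)
    (h1 : σ 1 = τ 1) : σ = τ := by
  have key : ∀ k : ℕ, ∀ hk : k + 1 < m + 3, σ ⟨k, by omega⟩ = τ ⟨k, by omega⟩ ∧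
      σ ⟨k + 1, hk⟩ = τ ⟨k + 1, hk⟩ := by
    intro k
    induction k with
    | zero => exact fun _ => ⟨h0, h1⟩
    | succ k ih =>
      intro hk
      obtain ⟨e0, e1⟩ := ih (by omega)
      refine ⟨e1, ?_⟩
      have hadj : (cycOf τ).Adj (σ ⟨k + 1, by omega⟩) (σ ⟨k + 1 + 1, hk⟩) := by
        rw [← h, cycOf_adj, cycleGraph_adj_iff_val]
        exact .inr (.inl rfl)
      obtain ⟨j, hj⟩ := τ.surjective (σ ⟨k + 1 + 1, hk⟩)
      rw [e1, ← hj, cycOf_adj, cycleGraph_adj_iff_val] at hadj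
      rw [← hj]
      congr 1
      rcases hadj with (h1 | ⟨h1, -⟩) | h1 | ⟨-, h1⟩
      · exfalso
        have hjk : j = ⟨k, by omega⟩ := Fin.ext (by simp only at h1 ⊢; omega)
        rw [hjk, ← e0] at hj
        have := congrArg Fin.val (σ.injective hj)
        simp only at this
        omega
      · have := congrArg Fin.val h1
        simp at this
      · exact Fin.ext h1
      · have := congrArg Fin.val h1
        simp only [Fin.val_last] at this
        omega
  ext ⟨k, hk⟩
  by_cases hk' : k + 1 < m + 3
  · exact (key k hk').1
  · obtain ⟨k, rfl⟩ : ∃ l, k = l + 1 := ⟨k - 1, by omega⟩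
    exact (key k hk).2

/-- A graph in which all degrees are odd is not uniquely hamiltonian. -/
theorem not_uniqueHC_of_odd [Finite V] {G C : SimpleGraph V} (hodd : ∀ v, Odd (dg G v))
    (h : UniqueHC G C) : False := by
  classical
  let _ := Fintype.ofFinite V
  obtain ⟨⟨hle, hC⟩, huniq⟩ := h
  obtain ⟨x⟩ := hC.conn.nonempty
  obtain ⟨y, hy⟩ := Set.nonempty_of_ncard_ne_zero (s := C.neighborSet x) (by
    have := hC.deg x; simp only [dg] at this; omega)
  have hcard : 3 ≤ Fintype.card V := by
    rw [← Nat.card_eq_fintype_card, ← Set.ncard_univ, Nat.succ_le_iff, ← hC.deg x]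
    refine Set.ncard_lt_ncard (Set.ssubset_univ_iff.2 fun hu => ?_) (Set.toFinite _)
    exact C.irrefl (show x ∈ C.neighborSet x from hu ▸ Set.mem_univ x)
  obtain ⟨m, hm⟩ : ∃ m, Fintype.card V = m + 2 + 1 := ⟨Fintype.card V - 3, by omega⟩
  obtain ⟨f, f0, f1, flast, -, fadj, fsurj⟩ := hC.exists_enum hy hm
  have hbij : Function.Bijective fun i : Fin (m + 3) => f i := by
    rw [Fintype.bijective_iff_surjective_and_card]
    refine ⟨fun v => ?_, by simp [hm]⟩
    obtain ⟨i, hi, hv⟩ := fsurj v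
    exact ⟨⟨i, by omega⟩, hv⟩
  let σ : Fin (m + 3) ≃ V := Equiv.ofBijective _ hbij
  have hσ : ∀ i, σ i = f i := fun i => rfl
  have hpath : IsHamPath G x y σ := by
    refine ⟨f0, f1, fun i j hij => ?_⟩
    have hj := j.2
    rw [hσ, hσ, hij]
    exact hle (fadj i (by omega))
  have hlast : G.Adj (σ 0) (σ (Fin.last _)) := by
    rw [hσ, hσ, Fin.val_last, Fin.val_zero, f0, ← flast]
    exact (hle (fadj (m + 2) le_rfl)).symm
  set S := Finset.univ.filter fun τ : Fin (m + 3) ≃ V =>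
    IsHamPath G x y τ ∧ G.Adj (τ 0) (τ (Fin.last _)) with hS
  have heven : Even S.card := even_card_closed_paths hodd
  have hmem : σ ∈ S := by simp [hS, hpath, hlast]
  obtain ⟨τ, hτ, hne⟩ : ∃ τ ∈ S, τ ≠ σ := by
    by_contra hcon
    push Not at hcon
    have : S = {σ} := Finset.eq_singleton_iff_unique_mem.2 ⟨hmem, hcon⟩
    rw [this, Finset.card_singleton] at heven
    exact absurd heven (by decide)
  obtain ⟨hτ1, hτ2⟩ := (Finset.mem_filter.1 hτ).2
  have hcyc : ∀ ρ : Fin (m + 3) ≃ V, IsHC (cycOf ρ) :=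
    fun ρ => isHC_comap_equiv ρ.symm isHC_cycleGraph
  refine hne (eq_of_cycOf_eq ?_ (hτ1.1.trans hpath.1.symm) (hτ1.2.1.trans hpath.2.1.symm))
  rw [huniq _ (cycOf_le hτ1 hτ2) (hcyc τ), huniq _ (cycOf_le hpath hlast) (hcyc σ)]

end Thomason

theorem exists_even_of_uhcRealizable {M : Finset ℕ} (h : UhcRealizable M) : ∃ d ∈ M, Even d := by
  obtain ⟨V, hV, G, -, hG, hdeg⟩ := h
  obtain ⟨C, hC⟩ := (isUniquelyHamiltonian_iff G).1 hG
  by_contra hcon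
  push Not at hcon
  refine not_uniqueHC_of_odd (fun v => ?_) hC
  refine Nat.not_even_iff_odd.1 (hcon _ ?_)
  rw [← Finset.mem_coe, ← hdeg, degreeSet_eq]
  exact ⟨v, rfl⟩

end UHC

theorem theorem3p3 (M : Finset ℕ) (hM : IsLeast (M : Set ℕ) 3) :
    (UHC.UhcRealizable M ↔ ∃ d ∈ M, Even d) ∧
      ((∃ d ∈ M, Even d) → UHC.StronglyUhcRealizable M) :=
  ⟨⟨UHC.exists_even_of_uhcRealizable, UHC.uhcRealizable_of_even hM⟩,
    UHC.stronglyUhcRealizable_of_even hM⟩
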